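/- **Theorem (zero elliptic residue local model).** Let $D=\{x_1=x_2=0\}\subset\mathbb{R}^4$, and let $\mathcal{A}_{|D|}$ be the elliptic tangent bundle, with global frame $r\partial_r=x_1\partial_1+x_2\partial_2$, $\partial_\theta=x_1\partial_2-x_2\partial_1$, $\partial_3$, $\partial_4$, dual coframe $d\log r, d\theta, dx_3, dx_4$ and anchor $\rho:\mathcal{A}_{|D|}\to T\mathbb{R}^4$. Let $\omega=d\log r\wedge dx_3+d\theta\wedge dx_4$ be the elliptic symplectic form with zero elliptic residue and let $\pi$ be the associated elliptic Poisson structure, $\pi^\sharp=\rho\circ(\omega^\flat)^{-1}\circ\rho^*$, i.e. $\pi=r\partial_r\wedge\partial_3+\partial_\theta\wedge\partial_4$ (with the convention $\pi^\sharp\alpha=\pi(\cdot,\alpha)$). Identify $\mathbb{R}^4\cong\mathbb{C}^2$ by $(x_1,x_2,x_3,x_4)\mapsto(x_1+ix_2,\;x_3-ix_4)$, and let $\mathcal{A}=(T^*\mathbb{C}^2,\pi^\sharp,[\cdot,\cdot]_\pi)$ be the cotangent Lie algebroid, $[\alpha,\beta]_\pi=L_{\pi^\sharp\alpha}\beta-L_{\pi^\sharp\beta}\alpha-d\langle\beta,\pi^\sharp\alpha\rangle$.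 Let $\beta:\widetilde{\mathbb{C}^4}\to\mathbb{C}^4=\mathbb{C}^2\times\mathbb{C}^2$ be the complex blow-up along $\{(0,z,0,z):z\in\mathbb{C}\}$ and put $$\mathcal{G}:=\widetilde{\mathbb{C}^4}\setminus\overline{\beta^{-1}\big[(\{0\}\times\mathbb{C}\times\mathbb{C}^*\times\mathbb{C})\cup(\mathbb{C}^*\times\mathbb{C}\times\{0\}\times\mathbb{C})\big]}.$$ Then: 1. $U:=\beta^{-1}[(\mathbb{C}^*\times\mathbb{C})^{\times2}]$ is contained in $\mathcal{G}$, and $\beta:U\to(\mathbb{C}^*\times\mathbb{C})^{\times 2}$ is a (biholomorphic) diffeomorphism. 2. $\mathcal{G}$ has global holomorphic coordinates $(z,a,b,c)\in\mathbb{C}^4$, $b\neq0$, in which $\beta(z,a,b,c)=(a,z,ab,ac+z)$. 3. The pair groupoid structure on $(\mathbb{C}^*\times\mathbb{C})^{\times2}$ (the arrow $(p,q)$ has target $p$ and source $q$), transported to $U$ along $\beta$, extends uniquely to a smooth Lie groupoid structure $\mathcal{G}\rightrightarrows\mathbb{C}^2$. Its source and target are $s(z,a,b,c)=(ab,ac+z)$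 and $t(z,a,b,c)=(a,z)$. 4. This Lie groupoid integrates $\mathcal{A}$: its Lie algebroid (the bundle $\ker ds$ along the units, with anchor $dt$ and the bracket of right-invariant vector fields) is isomorphic to $\mathcal{A}$ as a Lie algebroid over $\mathbb{C}^2$. -/

import Mathlib

open scoped Manifold ContDiff LinearAlgebra.Projectivization Topology

noncomputable section

namespace EllipticModel

/-! ### Lie groupoids and their Lie algebroids -/

section LieGroupoid

variable (E : Type*) [NormedAddCommGroup E] [NormedSpace ℝ E]
  (G : Type*) [TopologicalSpace G] [ChartedSpace E G]
  (F : Type*) [NormedAddCommGroup F] [NormedSpace ℝ F]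
  (M : Type*) [TopologicalSpace M] [ChartedSpace F M]

/-- A Lie groupoid `G ⇉ M` (real, smooth). The product `mul g h _` is the arrow `g · h`, defined
exactly when `src g = tgt h`. The value of the map in `contMDiffOn_mul` at a pair that is not
composable is irrelevant, because smoothness is only required on the fibre product. -/
@[ext]
structure LieGroupoid where
  src : G → M
  tgt : G → M
  one : M → G
  inv : G → G
  mul : ∀ g h : G, src g = tgt h → G
  src_mul : ∀ g h (hgh : src g = tgt h), src (mul g h hgh) = src h
  tgt_mul : ∀ g h (hgh : src g = tgt h), tgt (mul g h hgh) = tgt g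
  mul_assoc : ∀ g h k (hgh : src g = tgt h) (hhk : src h = tgt k),
    mul (mul g h hgh) k ((src_mul g h hgh).trans hhk) =
      mul g (mul h k hhk) (hgh.trans (tgt_mul h k hhk).symm)
  src_one : ∀ x, src (one x) = x
  tgt_one : ∀ x, tgt (one x) = x
  one_mul : ∀ g, mul (one (tgt g)) g (src_one (tgt g)) = g
  mul_one : ∀ g, mul g (one (src g)) (tgt_one (src g)).symm = g
  src_inv : ∀ g, src (inv g) = tgt g
  tgt_inv : ∀ g, tgt (inv g) = src g
  inv_mul : ∀ g, mul (inv g) g (src_inv g) = one (src g)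
  mul_inv : ∀ g, mul g (inv g) (tgt_inv g).symm = one (tgt g)
  contMDiff_src : ContMDiff 𝓘(ℝ, E) 𝓘(ℝ, F) ∞ src
  contMDiff_tgt : ContMDiff 𝓘(ℝ, E) 𝓘(ℝ, F) ∞ tgt
  src_submersion : ∀ g, Function.Surjective (mfderiv 𝓘(ℝ, E) 𝓘(ℝ, F) src g)
  tgt_submersion : ∀ g, Function.Surjective (mfderiv 𝓘(ℝ, E) 𝓘(ℝ, F) tgt g)
  contMDiff_one : ContMDiff 𝓘(ℝ, F) 𝓘(ℝ, E) ∞ one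
  contMDiff_inv : ContMDiff 𝓘(ℝ, E) 𝓘(ℝ, E) ∞ inv
  contMDiffOn_mul : ContMDiffOn (𝓘(ℝ, E).prod 𝓘(ℝ, E)) 𝓘(ℝ, E) ∞
    (fun p : G × G => open Classical in if h : src p.1 = tgt p.2 then mul p.1 p.2 h else p.1)
    {p | src p.1 = tgt p.2}

end LieGroupoid

namespace LieGroupoid

variable {E : Type*} [NormedAddCommGroup E] [NormedSpace ℝ E]
  {G : Type*} [TopologicalSpace G] [ChartedSpace E G]
  {F : Type*} [NormedAddCommGroup F] [NormedSpace ℝ F]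
  {M : Type*} [TopologicalSpace M] [ChartedSpace F M]

/-- Right translation `g ↦ g · h`, meaningful on the source fibre `src ⁻¹ {tgt h}`. -/
def rightMul (𝒢 : LieGroupoid E G F M) (h g : G) : G :=
  open Classical in if hgh : 𝒢.src g = 𝒢.tgt h then 𝒢.mul g h hgh else g

/-- `X` is a smooth right-invariant vector field on the arrows: it is tangent to the source fibres,
and the differential of each right translation `src ⁻¹ {tgt h} → src ⁻¹ {src h}`, `g ↦ g · h`,
maps `X g` to `X (g · h)`. -/
structure IsRightInvariant [IsManifold 𝓘(ℝ, E) ∞ G] (𝒢 : LieGroupoid E G F M)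
    (X : ∀ g : G, TangentSpace 𝓘(ℝ, E) g) : Prop where
  smooth : ContMDiff 𝓘(ℝ, E) 𝓘(ℝ, E).tangent ∞ (fun g => (⟨g, X g⟩ : TangentBundle 𝓘(ℝ, E) G))
  vertical : ∀ g, mfderiv 𝓘(ℝ, E) 𝓘(ℝ, F) 𝒢.src g (X g) = 0
  invariant : ∀ g h, 𝒢.src g = 𝒢.tgt h →
    ∃ L : TangentSpace 𝓘(ℝ, E) g →L[ℝ] TangentSpace 𝓘(ℝ, E) (𝒢.rightMul h g),
      HasMFDerivWithinAt 𝓘(ℝ, E) 𝓘(ℝ, E) (𝒢.rightMul h) (𝒢.src ⁻¹' {𝒢.tgt h}) g L ∧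
        L (X g) = X (𝒢.rightMul h g)

/-- The bracket of the Lie algebroid `ker (d src)` along the units: `ρ = [σ, τ]` when `σ`, `τ`
extend to right-invariant vector fields whose Lie bracket restricts to `ρ` along the units. -/
def IsAlgebroidBracket [IsManifold 𝓘(ℝ, E) ∞ G] (𝒢 : LieGroupoid E G F M)
    (σ τ ρ : ∀ x : M, TangentSpace 𝓘(ℝ, E) (𝒢.one x)) : Prop :=
  ∃ X Y : ∀ g : G, TangentSpace 𝓘(ℝ, E) g,
    𝒢.IsRightInvariant X ∧ 𝒢.IsRightInvariant Y ∧
    (∀ x, X (𝒢.one x) = σ x) ∧ (∀ x, Y (𝒢.one x) = τ x) ∧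
    ∀ x, VectorField.mlieBracket 𝓘(ℝ, E) X Y (𝒢.one x) = ρ x

end LieGroupoid

/-! ### Cotangent Lie algebroids -/

section Cotangent

variable {F : Type*} [NormedAddCommGroup F] [NormedSpace ℝ F]

/-- The Lie derivative `L_X β` of a one-form along a vector field on a vector space. -/
def lieDerivForm (X : F → F) (β : F → F →L[ℝ] ℝ) (x : F) : F →L[ℝ] ℝ :=
  fderiv ℝ β x (X x) + (β x).comp (fderiv ℝ X x)

/-- The bracket of one-forms
`[α, β]_π = L_{π♯ α} β - L_{π♯ β} α - d ⟨β, π♯ α⟩` of a Poisson structure given by `π♯`. -/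
def koszulBracket (sharp : F → (F →L[ℝ] ℝ) →L[ℝ] F) (α β : F → F →L[ℝ] ℝ) (x : F) : F →L[ℝ] ℝ :=
  lieDerivForm (fun y => sharp y (α y)) β x - lieDerivForm (fun y => sharp y (β y)) α x
    - fderiv ℝ (fun y => β y (sharp y (α y))) x

variable {E : Type*} [NormedAddCommGroup E] [NormedSpace ℝ E]
  {G : Type*} [TopologicalSpace G] [ChartedSpace E G] [IsManifold 𝓘(ℝ, E) ∞ G]

/-- The Lie groupoid `𝒢 ⇉ F` integrates the cotangent Lie algebroid `(T*F, π♯, [·,·]_π)`: there is a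
smooth isomorphism `φ` of vector bundles over the identity from `T*F` to the Lie algebroid
`ker (d src)` along the units (with anchor `d tgt` and the bracket of right-invariant vector
fields) that intertwines the anchors and the brackets. -/
def IntegratesCotangent (𝒢 : LieGroupoid E G F F) (sharp : F → (F →L[ℝ] ℝ) →L[ℝ] F) : Prop :=
  ∃ φ : ∀ x : F, (F →L[ℝ] ℝ) →ₗ[ℝ] TangentSpace 𝓘(ℝ, E) (𝒢.one x),
    (∀ x, Function.Injective (φ x)) ∧
    (∀ x, Set.range (φ x) = {v | mfderiv 𝓘(ℝ, E) 𝓘(ℝ, F) 𝒢.src (𝒢.one x) v = 0}) ∧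
    (∀ α : F → F →L[ℝ] ℝ, ContDiff ℝ ∞ α →
      ContMDiff 𝓘(ℝ, F) 𝓘(ℝ, E).tangent ∞
        (fun x => (⟨𝒢.one x, φ x (α x)⟩ : TangentBundle 𝓘(ℝ, E) G))) ∧
    (∀ x ξ, mfderiv 𝓘(ℝ, E) 𝓘(ℝ, F) 𝒢.tgt (𝒢.one x) (φ x ξ) = sharp x ξ) ∧
    ∀ α β : F → F →L[ℝ] ℝ, ContDiff ℝ ∞ α → ContDiff ℝ ∞ β →
      𝒢.IsAlgebroidBracket (fun x => φ x (α x)) (fun x => φ x (β x))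
        (fun x => φ x (koszulBracket sharp α β x))

end Cotangent

/-! ### The elliptic Poisson structure on `ℝ⁴` with zero residue -/

/-- `ℝ⁴` with its coordinates `x₁, …, x₄` (indexed by `0, …, 3`). -/
abbrev R4 := Fin 4 → ℝ

/-- The linear coordinate forms on `ℝ⁴`. -/
abbrev coordForm (i : Fin 4) : R4 →L[ℝ] ℝ := ContinuousLinearMap.proj i

/-- The anchor of the elliptic tangent bundle of `(ℝ⁴, {x₁ = x₂ = 0})` in its global frame
`r∂_r = x₁∂₁ + x₂∂₂`, `∂_θ = x₁∂₂ - x₂∂₁`, `∂₃`, `∂₄`. -/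
def ellipticAnchor (x : R4) : R4 →L[ℝ] R4 :=
  (coordForm 0).smulRight ![x 0, x 1, 0, 0] + (coordForm 1).smulRight ![-x 1, x 0, 0, 0]
    + (coordForm 2).smulRight ![0, 0, 1, 0] + (coordForm 3).smulRight ![0, 0, 0, 1]

/-- The map `v ↦ (α ∧ β)(v, ·)`. -/
def wedgeFlat (α β : R4 →L[ℝ] ℝ) : R4 →L[ℝ] (R4 →L[ℝ] ℝ) := α.smulRight β - β.smulRight α

/-- `ω♭` for the elliptic symplectic form `ω = d log r ∧ dx₃ + dθ ∧ dx₄`; the coordinate forms with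
respect to the frame of the elliptic tangent bundle are `d log r`, `dθ`, `dx₃`, `dx₄`. -/
def ellipticFlat : R4 →L[ℝ] (R4 →L[ℝ] ℝ) :=
  wedgeFlat (coordForm 0) (coordForm 2) + wedgeFlat (coordForm 1) (coordForm 3)

/-- `π♯ = ρ ∘ (ω♭)⁻¹ ∘ ρ*`, where `ρ` is the anchor of the elliptic tangent bundle. -/
def ellipticSharp (x : R4) : (R4 →L[ℝ] ℝ) →L[ℝ] R4 :=
  (ellipticAnchor x).comp
    (ellipticFlat.inverse.comp (ContinuousLinearMap.precomp ℝ (ellipticAnchor x)))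

/-- The identification `ℝ⁴ ≅ ℂ²`, `x ↦ (x₁ + i x₂, x₃ - i x₄)`. -/
def realCoords : R4 ≃L[ℝ] ℂ × ℂ :=
  LinearEquiv.toContinuousLinearEquiv
    { toFun := fun x => (⟨x 0, x 1⟩, ⟨x 2, -x 3⟩)
      invFun := fun p => ![p.1.re, p.1.im, p.2.re, -p.2.im]
      map_add' := by
        intro x y
        refine Prod.ext (Complex.ext ?_ ?_) (Complex.ext ?_ ?_) <;> (simp; try ring)
      map_smul' := by
        intro c x
        refine Prod.ext (Complex.ext ?_ ?_) (Complex.ext ?_ ?_) <;> simp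
      left_inv := by
        intro x
        ext i
        fin_cases i <;> simp
      right_inv := by
        intro p
        ext <;> simp }

/-- The elliptic Poisson structure on `ℂ²`, transported from `ℝ⁴`. -/
def poissonSharp (p : ℂ × ℂ) : ((ℂ × ℂ) →L[ℝ] ℝ) →L[ℝ] ℂ × ℂ :=
  (realCoords : R4 →L[ℝ] ℂ × ℂ).comp
    ((ellipticSharp (realCoords.symm p)).comp
      (ContinuousLinearMap.precomp ℝ (realCoords : R4 →L[ℝ] ℂ × ℂ)))

/-- The form `ω` is nondegenerate. -/
theorem ellipticFlat_isInvertible : ellipticFlat.IsInvertible := by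
  let inv : (R4 →L[ℝ] ℝ) →ₗ[ℝ] R4 :=
    { toFun := fun α => ![α (Pi.single 2 1), α (Pi.single 3 1), -α (Pi.single 0 1),
        -α (Pi.single 1 1)]
      map_add' := by
        intro α β
        ext i
        fin_cases i <;> simp <;> ring
      map_smul' := by
        intro c α
        ext i
        fin_cases i <;> simp }
  let e : R4 ≃ₗ[ℝ] (R4 →L[ℝ] ℝ) :=
    { (ellipticFlat : R4 →ₗ[ℝ] (R4 →L[ℝ] ℝ)) with
      invFun := inv
      left_inv := by
        intro v
        ext i
        fin_cases i <;> simp [inv, ellipticFlat, wedgeFlat]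
      right_inv := by
        intro α
        refine ContinuousLinearMap.coe_injective (LinearMap.pi_ext' fun i => ?_)
        ext
        fin_cases i <;> simp [inv, ellipticFlat, wedgeFlat] }
  exact ⟨e.toContinuousLinearEquiv, by ext; rfl⟩

/-- `π♯ α = α(∂₃) r∂_r + α(∂₄) ∂_θ - α(r∂_r) ∂₃ - α(∂_θ) ∂₄`, that is,
`π = r∂_r ∧ ∂₃ + ∂_θ ∧ ∂₄` with the convention `π♯ α = π(·, α)`. -/
theorem ellipticSharp_apply (x : R4) (α : R4 →L[ℝ] ℝ) :
    ellipticSharp x α =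
      α ![0, 0, 1, 0] • ![x 0, x 1, 0, 0] + α ![0, 0, 0, 1] • ![-x 1, x 0, 0, 0]
        - α ![x 0, x 1, 0, 0] • ![0, 0, 1, 0] - α ![-x 1, x 0, 0, 0] • ![0, 0, 0, 1] := by
  have key : ellipticFlat.inverse (α.comp (ellipticAnchor x)) =
      ![α ![0, 0, 1, 0], α ![0, 0, 0, 1], -α ![x 0, x 1, 0, 0], -α ![-x 1, x 0, 0, 0]] := by
    obtain ⟨e, he⟩ := ellipticFlat_isInvertible
    rw [← he, ContinuousLinearMap.inverse_equiv]
    change e.symm _ = _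
    rw [ContinuousLinearEquiv.symm_apply_eq]
    change _ = (e : R4 →L[ℝ] (R4 →L[ℝ] ℝ)) _
    rw [he]
    ext v
    have hv : ellipticAnchor x v = v 0 • ![x 0, x 1, 0, 0] + v 1 • ![-x 1, x 0, 0, 0]
        + v 2 • ![0, 0, 1, 0] + v 3 • ![0, 0, 0, 1] := rfl
    rw [ContinuousLinearMap.comp_apply, hv]
    simp only [map_add, map_smul]
    simp [ellipticFlat, wedgeFlat]
    ring
  change ellipticAnchor x (ellipticFlat.inverse (α.comp (ellipticAnchor x))) = _
  rw [key]
  simp [ellipticAnchor, sub_eq_add_neg]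

/-! ### The blow-up of `ℂ⁴` along `{(0, z, 0, z)}` -/

/-- The quotient topology on the complex projective plane. -/
instance : TopologicalSpace (ℙ ℂ (Fin 3 → ℂ)) :=
  inferInstanceAs (TopologicalSpace (Quotient (projectivizationSetoid ℂ (Fin 3 → ℂ))))

/-- The linear equations `(p₁, q₁, q₂ - p₂)` of the centre `{((0, z), (0, z))}` of the blow-up; a
point of `ℂ⁴` is written as `(p, q)` with `p, q ∈ ℂ²`. -/
def centreEq (x : (ℂ × ℂ) × (ℂ × ℂ)) : Fin 3 → ℂ := ![x.1.1, x.2.1, x.2.2 - x.1.2]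

theorem centreEq_eq_zero_iff (x : (ℂ × ℂ) × (ℂ × ℂ)) :
    centreEq x = 0 ↔ ∃ z : ℂ, x = ((0, z), (0, z)) := by
  constructor
  · intro h
    have h0 := congrFun h 0
    have h1 := congrFun h 1
    have h2 := congrFun h 2
    simp [centreEq, sub_eq_zero] at h0 h1 h2
    exact ⟨x.1.2, by ext <;> simp [h0, h1, h2]⟩
  · rintro ⟨z, rfl⟩
    ext i
    fin_cases i <;> simp [centreEq]

/-- The blow-up of `ℂ⁴` along `{((0, z), (0, z))}`: pairs of a point `x` and a line in the normal
space `ℂ³` that contains `(p₁, q₁, q₂ - p₂)`. -/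
@[ext]
structure BlowUp where
  pt : (ℂ × ℂ) × (ℂ × ℂ)
  line : ℙ ℂ (Fin 3 → ℂ)
  mem : centreEq pt ∈ line.submodule

/-- The subspace topology from `ℂ⁴ × ℙ²`. -/
instance : TopologicalSpace BlowUp := TopologicalSpace.induced (fun y => (y.pt, y.line)) inferInstance

/-- The blow-down map `β`. -/
def blowDown (y : BlowUp) : (ℂ × ℂ) × (ℂ × ℂ) := y.pt

theorem continuous_pt_line : Continuous fun y : BlowUp => (y.pt, y.line) := continuous_induced_dom

theorem continuous_blowDown : Continuous blowDown := continuous_fst.comp continuous_pt_line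

/-- The model space of the blow-up, a copy of `ℂ⁴`. -/
abbrev ChartModel := ℂ × ℂ × (Fin 2 → ℂ)

/-- The vector with `i`-th entry `1` and the remaining entries given by `y`. -/
def affineVec (i : Fin 3) (y : Fin 2 → ℂ) : Fin 3 → ℂ := i.insertNth (1 : ℂ) y

/-- The ratio `l_j / l_i` of homogeneous coordinates. -/
def ratio (i j : Fin 3) (l : ℙ ℂ (Fin 3 → ℂ)) : ℂ := l.rep j / l.rep i

theorem ratio_mk (i j : Fin 3) (u : Fin 3 → ℂ) (hu : u ≠ 0) :
    ratio i j (Projectivization.mk ℂ u hu) = u j / u i := by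
  obtain ⟨a, ha⟩ := Projectivization.exists_smul_eq_mk_rep ℂ u hu
  rw [ratio, ← ha]
  simp only [Pi.smul_apply, Units.smul_def, smul_eq_mul]
  exact mul_div_mul_left _ _ a.ne_zero

theorem rep_mk_ne_zero_iff (i : Fin 3) (u : Fin 3 → ℂ) (hu : u ≠ 0) :
    (Projectivization.mk ℂ u hu).rep i ≠ 0 ↔ u i ≠ 0 := by
  obtain ⟨a, ha⟩ := Projectivization.exists_smul_eq_mk_rep ℂ u hu
  rw [← ha]
  simp [Units.smul_def]

theorem affineVec_ne_zero (i : Fin 3) (y : Fin 2 → ℂ) : affineVec i y ≠ 0 := by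
  intro h
  simpa [affineVec] using congrFun h i

/-- The parametrization of the `i`-th affine chart: the line is spanned by `u = affineVec i y` and
`(p₁, q₁, q₂ - p₂) = c • u`, `p₂ = z`. -/
def chartInv (i : Fin 3) (m : ChartModel) : BlowUp :=
  ⟨((m.2.1 * affineVec i m.2.2 0, m.1),
      (m.2.1 * affineVec i m.2.2 1, m.1 + m.2.1 * affineVec i m.2.2 2)),
    Projectivization.mk ℂ (affineVec i m.2.2) (affineVec_ne_zero i m.2.2), by
    rw [Projectivization.submodule_mk]
    refine Submodule.mem_span_singleton.2 ⟨m.2.1, ?_⟩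
    ext k
    fin_cases k <;> simp [centreEq]⟩

/-- The coordinates of the `i`-th affine chart: `p₂`, the `i`-th entry of `(p₁, q₁, q₂ - p₂)`, and
the two ratios of homogeneous coordinates of the line with denominator `l_i`. -/
def chartFun (i : Fin 3) (y : BlowUp) : ChartModel :=
  (y.pt.1.2, centreEq y.pt i, fun k => ratio i (i.succAbove k) y.line)

theorem isQuotientMap_mk : Topology.IsQuotientMap
    (fun v : {v : Fin 3 → ℂ // v ≠ 0} => Projectivization.mk ℂ v.1 v.2) :=
  isQuotientMap_quotient_mk'

theorem isOpen_rep_ne_zero (i : Fin 3) : IsOpen {l : ℙ ℂ (Fin 3 → ℂ) | l.rep i ≠ 0} := by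
  rw [← isQuotientMap_mk.isOpen_preimage]
  have : ((fun v : {v : Fin 3 → ℂ // v ≠ 0} => Projectivization.mk ℂ v.1 v.2) ⁻¹'
      {l : ℙ ℂ (Fin 3 → ℂ) | l.rep i ≠ 0}) = {v | v.1 i ≠ 0} := by
    ext v
    exact rep_mk_ne_zero_iff i v.1 v.2
  rw [this]
  exact isOpen_ne_fun ((continuous_apply i).comp continuous_subtype_val) continuous_const

theorem continuousOn_ratio (i j : Fin 3) :
    ContinuousOn (ratio i j) {l : ℙ ℂ (Fin 3 → ℂ) | l.rep i ≠ 0} := by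
  rw [isQuotientMap_mk.continuousOn_isOpen_iff (isOpen_rep_ne_zero i)]
  have : (ratio i j ∘ fun v : {v : Fin 3 → ℂ // v ≠ 0} => Projectivization.mk ℂ v.1 v.2) =
      fun v => v.1 j / v.1 i := by
    ext v
    exact ratio_mk i j v.1 v.2
  rw [this]
  refine ContinuousOn.div ?_ ?_ ?_
  · exact ((continuous_apply j).comp continuous_subtype_val).continuousOn
  · exact ((continuous_apply i).comp continuous_subtype_val).continuousOn
  · intro v hv
    exact (rep_mk_ne_zero_iff i v.1 v.2).1 hv

theorem continuous_affineVec (i : Fin 3) : Continuous (affineVec i) := by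
  unfold affineVec
  fun_prop

theorem affineVec_ratio (i : Fin 3) (l : ℙ ℂ (Fin 3 → ℂ)) (hl : l.rep i ≠ 0) :
    l.rep i • affineVec i (fun k => ratio i (i.succAbove k) l) = l.rep := by
  ext k
  refine Fin.succAboveCases i ?_ (fun k => ?_) k
  · simp [affineVec]
  · simp [affineVec, ratio]
    field_simp

/-- The `i`-th affine chart of the blow-up, defined where the `i`-th homogeneous coordinate of the
line does not vanish. -/
def blowUpChart (i : Fin 3) : OpenPartialHomeomorph BlowUp ChartModel where
  toFun := chartFun i
  invFun := chartInv i
  source := {y | y.line.rep i ≠ 0}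
  target := Set.univ
  map_source' := fun _ _ => Set.mem_univ _
  map_target' := by
    intro m _
    refine (rep_mk_ne_zero_iff i _ (affineVec_ne_zero i m.2.2)).2 ?_
    simp [affineVec]
  left_inv' := by
    rintro ⟨x, l, hx⟩ hl
    change l.rep i ≠ 0 at hl
    have hu := affineVec_ratio i l hl
    set u := affineVec i (fun k => ratio i (i.succAbove k) l) with hu_def
    have hui : u i = 1 := by simp [hu_def, affineVec]
    obtain ⟨t, ht⟩ : ∃ t : ℂ, t • u = centreEq x := by
      rw [Projectivization.submodule_eq] at hx
      obtain ⟨t, ht⟩ := Submodule.mem_span_singleton.1 hx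
      exact ⟨t * l.rep i, by rw [mul_smul, hu, ht]⟩
    have hti : centreEq x i = t := by rw [← ht]; simp [hui]
    have h0 := congrFun ht 0
    have h1 := congrFun ht 1
    have h2 := congrFun ht 2
    simp [centreEq] at h0 h1 h2
    refine BlowUp.ext ?_ ?_
    · change ((centreEq x i * u 0, x.1.2), (centreEq x i * u 1, x.1.2 + centreEq x i * u 2)) = x
      rw [hti, h0, h1, h2]
      ext <;> simp
    · change Projectivization.mk ℂ u _ = l
      conv_rhs => rw [← l.mk_rep]
      refine (Projectivization.mk_eq_mk_iff' ℂ _ _ _ _).2 ?_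
      exact ⟨(l.rep i)⁻¹, (inv_smul_eq_iff₀ hl).2 hu.symm⟩
  right_inv' := by
    rintro ⟨z, c, y⟩ -
    refine Prod.ext rfl (Prod.ext ?_ ?_)
    · have : centreEq (chartInv i (z, c, y)).pt = c • affineVec i y := by
        ext k
        fin_cases k <;> simp [centreEq, chartInv]
      change centreEq (chartInv i (z, c, y)).pt i = c
      rw [this]
      simp [affineVec]
    · ext k
      change ratio i (i.succAbove k) (Projectivization.mk ℂ (affineVec i y) _) = y k
      rw [ratio_mk]
      simp [affineVec]
  open_source := (isOpen_rep_ne_zero i).preimage (continuous_snd.comp continuous_pt_line)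
  open_target := isOpen_univ
  continuousOn_toFun := by
    have hx : Continuous fun y : BlowUp => y.pt := continuous_blowDown
    have hl : Continuous fun y : BlowUp => y.line := continuous_snd.comp continuous_pt_line
    have hc : Continuous fun y : BlowUp => centreEq y.pt := by
      refine continuous_pi fun k => ?_
      fin_cases k <;> simp only [centreEq] <;> simp <;> fun_prop
    refine ContinuousOn.prodMk (by fun_prop) (ContinuousOn.prodMk
      ((continuous_apply i).comp hc).continuousOn (continuousOn_pi.2 fun k => ?_))
    exact (continuousOn_ratio i (i.succAbove k)).comp hl.continuousOn fun y hy => hy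
  continuousOn_invFun := by
    have hu : Continuous fun m : ChartModel => affineVec i m.2.2 :=
      (continuous_affineVec i).comp (by fun_prop)
    have hk : ∀ k, Continuous fun m : ChartModel => affineVec i m.2.2 k :=
      fun k => (continuous_apply k).comp hu
    refine Continuous.continuousOn (continuous_induced_rng.2 (Continuous.prodMk ?_ ?_))
    · have h0 := hk 0
      have h1 := hk 1
      have h2 := hk 2
      fun_prop
    · exact isQuotientMap_mk.continuous.comp
        (hu.subtype_mk fun m => affineVec_ne_zero i m.2.2)

theorem exists_rep_ne_zero (y : BlowUp) : ∃ i : Fin 3, y.line.rep i ≠ 0 := by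
  by_contra! h
  exact y.line.rep_nonzero (funext h)

/-- The complex manifold structure of the blow-up, given by the three affine charts. -/
instance : ChartedSpace ChartModel BlowUp where
  atlas := Set.range blowUpChart
  chartAt y := blowUpChart (exists_rep_ne_zero y).choose
  mem_chart_source y := (exists_rep_ne_zero y).choose_spec
  chart_mem_atlas _ := Set.mem_range_self _

theorem contDiff_affineVec (i k : Fin 3) {n : ℕ∞ω} :
    ContDiff ℂ n fun m : ChartModel => affineVec i m.2.2 k := by
  refine Fin.succAboveCases i ?_ (fun k => ?_) k
  · simp only [affineVec, Fin.insertNth_apply_same]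
    exact contDiff_const
  · simp only [affineVec, Fin.insertNth_apply_succAbove]
    fun_prop

theorem contDiffOn_transition (i j : Fin 3) {n : ℕ∞ω} :
    ContDiffOn ℂ n (chartFun j ∘ chartInv i) {m | affineVec i m.2.2 j ≠ 0} := by
  have hfun : chartFun j ∘ chartInv i = fun m : ChartModel =>
      ((m.1, m.2.1 * affineVec i m.2.2 j,
        fun k => affineVec i m.2.2 (j.succAbove k) / affineVec i m.2.2 j) : ChartModel) := by
    funext m
    refine Prod.ext rfl (Prod.ext ?_ ?_)
    · change centreEq (chartInv i m).pt j = _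
      fin_cases j <;> simp [centreEq, chartInv]
    · funext k
      exact ratio_mk j (j.succAbove k) _ _
  rw [hfun]
  refine ContDiffOn.prodMk contDiff_fst.contDiffOn (ContDiffOn.prodMk ?_ ?_)
  · exact (ContDiff.mul (by fun_prop) (contDiff_affineVec i j)).contDiffOn
  · refine contDiffOn_pi.2 fun k => ?_
    exact (contDiff_affineVec i _).contDiffOn.div (contDiff_affineVec i j).contDiffOn fun m hm => hm

theorem transition_source (i j : Fin 3) :
    ((blowUpChart i).symm.trans (blowUpChart j)).source = {m | affineVec i m.2.2 j ≠ 0} := by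
  ext m
  have : m ∈ ((blowUpChart i).symm.trans (blowUpChart j)).source ↔
      (chartInv i m).line.rep j ≠ 0 := by
    change (True ∧ _) ↔ _
    exact iff_of_eq (true_and _)
  rw [this]
  exact rep_mk_ne_zero_iff j _ (affineVec_ne_zero i m.2.2)

@[simp]
theorem coe_blowUpChart (i : Fin 3) : (blowUpChart i : BlowUp → ChartModel) = chartFun i := rfl

@[simp]
theorem coe_blowUpChart_symm (i : Fin 3) :
    ((blowUpChart i).symm : ChartModel → BlowUp) = chartInv i := rfl

/-- The blow-up is a complex analytic manifold. -/
instance : IsManifold 𝓘(ℂ, ChartModel) ω BlowUp := by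
  refine isManifold_of_contDiffOn _ _ _ ?_
  rintro _ _ ⟨i, rfl⟩ ⟨j, rfl⟩
  have h := contDiffOn_transition i j (n := ω)
  rw [← transition_source] at h
  simpa using h

/-- The underlying smooth real manifold of the blow-up. -/
instance : IsManifold 𝓘(ℝ, ChartModel) ∞ BlowUp := by
  refine isManifold_of_contDiffOn _ _ _ ?_
  rintro _ _ ⟨i, rfl⟩ ⟨j, rfl⟩
  have h := (contDiffOn_transition i j (n := ∞)).restrict_scalars ℝ
  rw [← transition_source] at h
  simpa using h

/-! ### The arrow space and the pair groupoid -/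

/-- `(ℂ^* × ℂ) × (ℂ^* × ℂ)` as an open subset of `ℂ⁴`. -/
def pairArrows : TopologicalSpace.Opens ((ℂ × ℂ) × (ℂ × ℂ)) :=
  ⟨{x | x.1.1 ≠ 0 ∧ x.2.1 ≠ 0},
    (isOpen_ne_fun (by fun_prop) (by fun_prop)).inter (isOpen_ne_fun (by fun_prop) (by fun_prop))⟩

/-- The arrow space `𝒢`: the complement in the blow-up of the closure of the inverse image of
`({0} × ℂ × ℂ^* × ℂ) ∪ (ℂ^* × ℂ × {0} × ℂ)`. -/
def Arrows : TopologicalSpace.Opens BlowUp :=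
  ⟨(closure (blowDown ⁻¹' ({x | x.1.1 = 0 ∧ x.2.1 ≠ 0} ∪ {x | x.1.1 ≠ 0 ∧ x.2.1 = 0})))ᶜ,
    isClosed_closure.isOpen_compl⟩

/-- `β⁻¹((ℂ^* × ℂ)²)` inside the arrow space. -/
def regularArrows : TopologicalSpace.Opens Arrows :=
  ⟨{g | blowDown g.1 ∈ pairArrows},
    pairArrows.isOpen.preimage (continuous_blowDown.comp continuous_subtype_val)⟩

/-- The coordinate domain `{(z, a, b, c) | b ≠ 0}`. -/
def coordDomain : TopologicalSpace.Opens (ℂ × ℂ × ℂ × ℂ) :=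
  ⟨{m | m.2.2.1 ≠ 0}, isOpen_ne_fun (by fun_prop) (by fun_prop)⟩

/-- The structure maps of `𝒢` restrict, over `ℂ^* × ℂ`, to those of the pair groupoid, transported
along `β`: the arrow `(p, q)` has target `p` and source `q`, and `(p, q) · (q, r) = (p, r)`. -/
structure ExtendsPairGroupoid (𝒢 : LieGroupoid ChartModel Arrows (ℂ × ℂ) (ℂ × ℂ)) : Prop where
  tgt_eq : ∀ g ∈ regularArrows, 𝒢.tgt g = (blowDown g.1).1
  src_eq : ∀ g ∈ regularArrows, 𝒢.src g = (blowDown g.1).2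
  one_eq : ∀ p : ℂ × ℂ, p.1 ≠ 0 → blowDown (𝒢.one p).1 = (p, p)
  inv_eq : ∀ g ∈ regularArrows, blowDown (𝒢.inv g).1 = ((blowDown g.1).2, (blowDown g.1).1)
  mul_eq : ∀ g ∈ regularArrows, ∀ h ∈ regularArrows, ∀ hgh : 𝒢.src g = 𝒢.tgt h,
    blowDown (𝒢.mul g h hgh).1 = ((blowDown g.1).1, (blowDown h.1).2)

end EllipticModel

end

/-!
The line `(l₀ : l₁ : l₂)` of a point of the blow-up satisfies `l₀ ≠ 0` and `l₁ ≠ 0` exactly on the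
arrow space, so `b = l₁ / l₀` and `c = l₂ / l₀` complete `z`, `a` to global coordinates. In these,
the product of the pair groupoid becomes `(b₁, c₁) (b₂, c₂) = (b₁ b₂, b₁ c₂ + c₁)`, the product of
the affine group, and the extension is the action groupoid of `(a, z) · (b, c) = (a b, a c + z)`. It
is unique because the regular arrows are dense, and so are the composable pairs of regular arrows
among all composable pairs.

Writing real covectors as `Re Ω(w, ·)` with `Ω = dz₁ ∧ dz₂` and `w ∈ ℂ²` turns `π♯` into
multiplication by the first coordinate. A right-invariant vector field is likewise given along the
units by a function `w : ℂ² → ℂ²`, its image under `dt` is again the first coordinate times `w`, and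
on such functions the Koszul bracket and the bracket of right-invariant fields are the same formula.
-/

noncomputable section

namespace EllipticModel

/-! ### Smooth maps between manifolds -/

section Manifold

variable {𝕜 : Type*} [NontriviallyNormedField 𝕜]
  {E : Type*} [NormedAddCommGroup E] [NormedSpace 𝕜 E] {H : Type*} [TopologicalSpace H]
  {I : ModelWithCorners 𝕜 E H} {M : Type*} [TopologicalSpace M] [ChartedSpace H M]
  {E' : Type*} [NormedAddCommGroup E'] [NormedSpace 𝕜 E'] {H' : Type*} [TopologicalSpace H']
  {I' : ModelWithCorners 𝕜 E' H'} {M' : Type*} [TopologicalSpace M'] [ChartedSpace H' M']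
  {n : ℕ∞ω}

theorem isLocalDiffeomorph_subtypeVal (U : TopologicalSpace.Opens M) :
    IsLocalDiffeomorph I I n (Subtype.val : U → M) := fun x => by
  let e := U.openPartialHomeomorphSubtypeCoe ⟨x⟩
  refine ⟨⟨e.toPartialEquiv, e.open_source, e.open_target,
    contMDiff_subtype_val.contMDiffOn, fun y hy => ?_⟩, Set.mem_univ x, fun _ _ => rfl⟩
  have hid : ContMDiffWithinAt I I n (Subtype.val ∘ e.symm) e.target y :=
    contMDiffWithinAt_id.congr (fun _ hz => e.right_inv hz) (e.right_inv hy)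
  exact (ChartedSpace.liftPropWithinAt_subtypeVal_comp_iff _ _ _).1 hid

theorem surjective_mfderiv_of_section {f : M → M'} {σ : M' → M} {x : M}
    (hf : MDifferentiableAt I I' f x) (hσ : MDifferentiableAt I' I σ (f x))
    (hfσ : Function.RightInverse σ f) (hx : σ (f x) = x) :
    Function.Surjective (mfderiv I I' f x) := by
  have hf' : MDifferentiableAt I I' f (σ (f x)) := hx.symm ▸ hf
  have hcomp := hf'.hasMFDerivAt.comp (f x) hσ.hasMFDerivAt
  rw [hfσ.id] at hcomp
  have hid := hasMFDerivAt_unique hcomp (hasMFDerivAt_id (f x))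
  rw [hx] at hid
  exact fun v => ⟨_, DFunLike.congr_fun hid v⟩

theorem mlieBracket_eq_lieBracket (X Y : ∀ x : E, TangentSpace 𝓘(𝕜, E) x) :
    VectorField.mlieBracket 𝓘(𝕜, E) X Y = VectorField.lieBracket 𝕜 X Y := by
  rw [← VectorField.mlieBracketWithin_univ, VectorField.mlieBracketWithin_eq_lieBracketWithin]
  exact VectorField.lieBracketWithin_univ

end Manifold

/-! ### Determination of a Lie groupoid by its product -/

namespace LieGroupoid

variable {E : Type*} [NormedAddCommGroup E] [NormedSpace ℝ E]
  {G : Type*} [TopologicalSpace G] [ChartedSpace E G]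
  {F : Type*} [NormedAddCommGroup F] [NormedSpace ℝ F]
  {M : Type*} [TopologicalSpace M] [ChartedSpace F M]

theorem ext_of_mul {𝒢 ℋ : LieGroupoid E G F M} (hsrc : 𝒢.src = ℋ.src) (htgt : 𝒢.tgt = ℋ.tgt)
    (hmul : ∀ g h hgh hgh', 𝒢.mul g h hgh = ℋ.mul g h hgh') : 𝒢 = ℋ := by
  have hone : 𝒢.one = ℋ.one := funext fun x => by
    have h₁ := ℋ.mul_one (𝒢.one x)
    have h₂ := 𝒢.one_mul (ℋ.one x)
    simp only [← hsrc, 𝒢.src_one] at h₁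
    simp only [htgt, ℋ.tgt_one] at h₂
    rw [← hmul _ _ ((𝒢.src_one x).trans ((congrFun htgt _).trans (ℋ.tgt_one x)).symm)] at h₁
    exact h₁.symm.trans h₂
  have hinv : 𝒢.inv = ℋ.inv := funext fun g => by
    have hg : 𝒢.src g = 𝒢.tgt (ℋ.inv g) := by rw [hsrc, htgt, ℋ.tgt_inv]
    have hassoc := 𝒢.mul_assoc (𝒢.inv g) g (ℋ.inv g) (𝒢.src_inv g) hg
    have hgi : 𝒢.mul g (ℋ.inv g) hg = 𝒢.one (𝒢.tgt g) := by
      rw [hmul _ _ _ (ℋ.tgt_inv g).symm, ℋ.mul_inv, hone, htgt]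
    have hl := 𝒢.one_mul (ℋ.inv g)
    have hr := 𝒢.mul_one (𝒢.inv g)
    simp only [𝒢.inv_mul, hgi] at hassoc
    simp only [← hg] at hl
    simp only [𝒢.src_inv] at hr
    rw [← hr, ← hassoc, hl]
  refine LieGroupoid.ext hsrc htgt hone hinv ?_
  refine Function.hfunext rfl fun g g' hg => Function.hfunext rfl fun h h' hh => ?_
  cases hg
  cases hh
  refine Function.hfunext (by rw [hsrc, htgt]) fun hgh hgh' _ => heq_of_eq (hmul g h hgh hgh')

theorem ext_of_dense [T2Space G] [T2Space M] {𝒢 ℋ : LieGroupoid E G F M} {D : Set G} (hD : Dense D)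
    (hcomp : {p : G × G | ℋ.src p.1 = ℋ.tgt p.2} ⊆
      closure {p | p ∈ D ×ˢ D ∧ ℋ.src p.1 = ℋ.tgt p.2})
    (hsrc : Set.EqOn 𝒢.src ℋ.src D) (htgt : Set.EqOn 𝒢.tgt ℋ.tgt D)
    (hmul : ∀ g ∈ D, ∀ h ∈ D, ∀ hgh hgh', 𝒢.mul g h hgh = ℋ.mul g h hgh') : 𝒢 = ℋ := by
  have hs : 𝒢.src = ℋ.src :=
    𝒢.contMDiff_src.continuous.ext_on hD ℋ.contMDiff_src.continuous hsrc
  have ht : 𝒢.tgt = ℋ.tgt :=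
    𝒢.contMDiff_tgt.continuous.ext_on hD ℋ.contMDiff_tgt.continuous htgt
  refine ext_of_mul hs ht fun g h hgh hgh' => ?_
  have hmul𝒢 := 𝒢.contMDiffOn_mul.continuousOn.mono
    (t := {p : G × G | ℋ.src p.1 = ℋ.tgt p.2}) (by rw [hs, ht])
  have hmulEq := Set.EqOn.of_subset_closure (fun p hp => ?_) hmul𝒢
    ℋ.contMDiffOn_mul.continuousOn (fun p hp => hp.2) hcomp
  · simpa only [hgh, hgh', dite_true] using hmulEq (x := (g, h)) hgh'
  · have hp' : 𝒢.src p.1 = 𝒢.tgt p.2 := by rw [hs, ht, hp.2]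
    simpa only [hp', hp.2, dite_true] using hmul _ hp.1.1 _ hp.1.2 hp' hp.2

end LieGroupoid

/-! ### The Koszul bracket -/

theorem koszulBracket_apply {F : Type*} [NormedAddCommGroup F] [NormedSpace ℝ F]
    {sharp : F → (F →L[ℝ] ℝ) →L[ℝ] F} {α β : F → F →L[ℝ] ℝ} {x : F}
    (hβ : DifferentiableAt ℝ β x) (hX : DifferentiableAt ℝ (fun y => sharp y (α y)) x) (v : F) :
    koszulBracket sharp α β x v =
      fderiv ℝ β x (sharp x (α x)) v - fderiv ℝ α x (sharp x (β x)) v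
        - α x (fderiv ℝ (fun y => sharp y (β y)) x v) - fderiv ℝ β x v (sharp x (α x)) := by
  simp only [koszulBracket, lieDerivForm, fderiv_clm_apply hβ hX, sub_apply,
    add_apply, ContinuousLinearMap.comp_apply, ContinuousLinearMap.flip_apply]
  ring

/-! ### The arrow space inside the blow-up -/

theorem centreEq_chartInv (i : Fin 3) (m : ChartModel) :
    centreEq (chartInv i m).pt = m.2.1 • affineVec i m.2.2 := by
  ext k
  fin_cases k <;> simp [centreEq, chartInv]

theorem exists_smul_rep_eq_centreEq (y : BlowUp) : ∃ t : ℂ, t • y.line.rep = centreEq y.pt := by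
  have hy := y.mem
  rw [Projectivization.submodule_eq] at hy
  exact Submodule.mem_span_singleton.1 hy

theorem rep_ne_zero_of_centreEq_ne_zero {j : Fin 3} {y : BlowUp} (hj : centreEq y.pt j ≠ 0) :
    y.line.rep j ≠ 0 := by
  obtain ⟨t, ht⟩ := exists_smul_rep_eq_centreEq y
  rw [← ht] at hj
  exact right_ne_zero_of_mul hj

theorem rep_eq_zero_of_centreEq_eq_zero {j : Fin 3} {y : BlowUp} (hj : centreEq y.pt j = 0)
    (hy : centreEq y.pt ≠ 0) : y.line.rep j = 0 := by
  obtain ⟨t, ht⟩ := exists_smul_rep_eq_centreEq y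
  rw [← ht] at hj hy
  exact (mul_eq_zero.1 hj).resolve_left (left_ne_zero_of_smul hy)

theorem rep_chartInv_eq_zero_iff (i j : Fin 3) (m : ChartModel) :
    (chartInv i m).line.rep j = 0 ↔ affineVec i m.2.2 j = 0 :=
  not_iff_not.1 (rep_mk_ne_zero_iff j _ (affineVec_ne_zero i m.2.2))

theorem continuous_chartInv (i : Fin 3) : Continuous (chartInv i) :=
  continuousOn_univ.1 (blowUpChart i).continuousOn_invFun

theorem eventually_add_ne_zero (c : ℂ) : ∀ᶠ t in 𝓝[≠] (0 : ℂ), c + t ≠ 0 :=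
  ((Filter.eventually_cofinite_ne (-c)).filter_mono (nhdsNE_le_cofinite 0)).mono
    fun _ ht hct => ht (eq_neg_of_add_eq_zero_right hct)

theorem affineVec_eq_zero_deform {i j : Fin 3} {u : Fin 2 → ℂ} (hj : affineVec i u j = 0) (t : ℂ) :
    affineVec i (u + t • fun l => if i.succAbove l = j then 0 else 1) j = 0 := by
  have hji : j ≠ i := by
    rintro rfl
    simp [affineVec] at hj
  obtain ⟨l, rfl⟩ := Fin.exists_succAbove_eq hji
  simpa [affineVec] using hj

theorem eventually_affineVec_deform_ne_zero {j k : Fin 3} (hkj : k ≠ j) (i : Fin 3)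
    (u : Fin 2 → ℂ) : ∀ᶠ t in 𝓝[≠] (0 : ℂ),
      affineVec i (u + t • fun l => if i.succAbove l = j then 0 else 1) k ≠ 0 := by
  rcases eq_or_ne k i with rfl | hki
  · simp [affineVec]
  · obtain ⟨l, rfl⟩ := Fin.exists_succAbove_eq hki
    simpa [affineVec, hkj] using eventually_add_ne_zero (u l)

theorem mem_closure_of_rep_eq_zero {j k : Fin 3} (hkj : k ≠ j) {y : BlowUp}
    (hj : y.line.rep j = 0) :
    y ∈ closure {x : BlowUp | centreEq x.pt j = 0 ∧ centreEq x.pt k ≠ 0} := by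
  obtain ⟨i, hi⟩ := exists_rep_ne_zero y
  obtain ⟨⟨z, c, u⟩, rfl⟩ : ∃ m, chartInv i m = y := ⟨_, (blowUpChart i).left_inv hi⟩
  replace hj : affineVec i u j = 0 := (rep_chartInv_eq_zero_iff i j _).1 hj
  -- inside `{l_j = 0}`, move off the exceptional divisor and off the hyperplane `l_k = 0` at once
  let w : Fin 2 → ℂ := fun l => if i.succAbove l = j then 0 else 1
  let γ : ℂ → BlowUp := fun t => chartInv i (z, c + t, u + t • w)
  have hγ : Continuous γ := (continuous_chartInv i).comp (by fun_prop)
  have hlim : Filter.Tendsto γ (𝓝[≠] 0) (𝓝 (chartInv i (z, c, u))) := by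
    simpa [γ] using hγ.continuousAt.tendsto.mono_left (nhdsWithin_le_nhds (s := {0}ᶜ) (a := 0))
  refine mem_closure_of_tendsto hlim ?_
  filter_upwards [eventually_affineVec_deform_ne_zero hkj i u, eventually_add_ne_zero c]
    with t hkt hct
  simp only [γ, centreEq_chartInv, Pi.smul_apply, smul_eq_mul]
  exact ⟨mul_eq_zero_of_right _ (affineVec_eq_zero_deform hj t), mul_ne_zero hct hkt⟩

theorem mem_arrows_iff (y : BlowUp) : y ∈ Arrows ↔ y.line.rep 0 ≠ 0 ∧ y.line.rep 1 ≠ 0 := by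
  refine ⟨fun h => ⟨fun h₀ => h ?_, fun h₁ => h ?_⟩, fun ⟨h₀, h₁⟩ h => ?_⟩
  · exact closure_mono (fun _ => Or.inl)
      (mem_closure_of_rep_eq_zero (k := 1) (by decide) h₀)
  · exact closure_mono (fun _ hx => Or.inr hx.symm)
      (mem_closure_of_rep_eq_zero (k := 0) (by decide) h₁)
  · have hline : Continuous BlowUp.line := continuous_snd.comp continuous_pt_line
    obtain ⟨x, ⟨hx₀, hx₁⟩, hx | hx⟩ := mem_closure_iff.1 h _
      (((isOpen_rep_ne_zero 0).preimage hline).inter ((isOpen_rep_ne_zero 1).preimage hline))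
      ⟨h₀, h₁⟩
    · exact hx₀ (rep_eq_zero_of_centreEq_eq_zero hx.1 (fun h => hx.2 (congrFun h 1)))
    · exact hx₁ (rep_eq_zero_of_centreEq_eq_zero hx.2 (fun h => hx.1 (congrFun h 0)))

theorem preimage_pairArrows_subset : blowDown ⁻¹' pairArrows ⊆ Arrows := fun y ⟨h₀, h₁⟩ =>
  (mem_arrows_iff y).2
    ⟨rep_ne_zero_of_centreEq_ne_zero h₀, rep_ne_zero_of_centreEq_ne_zero h₁⟩

/-! ### Global coordinates on the arrow space -/

/-- The point `(z, a, ![b, c])` of the model space of the blow-up. -/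
def toModel (m : ℂ × ℂ × ℂ × ℂ) : ChartModel := (m.1, m.2.1, ![m.2.2.1, m.2.2.2])

/-- The point `(z, a, b, c)` of `ℂ⁴` that corresponds to `(z, a, y)` in the model space. -/
def ofModel (m : ChartModel) : ℂ × ℂ × ℂ × ℂ := (m.1, m.2.1, m.2.2 0, m.2.2 1)

theorem toModel_ofModel (m : ChartModel) : toModel (ofModel m) = m :=
  congrArg (fun y => (m.1, m.2.1, y)) ((finTwoArrowEquiv ℂ).symm_apply_apply m.2.2)

/-- The arrow with coordinates `(z, a, b, c)`. -/
def ofCoords (m : coordDomain) : Arrows :=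
  ⟨chartInv 0 (toModel m), (mem_arrows_iff _).2
    ⟨mt (rep_chartInv_eq_zero_iff 0 0 _).1 one_ne_zero, mt (rep_chartInv_eq_zero_iff 0 1 _).1 m.2⟩⟩

/-- The coordinates `(z, a, b, c)` of an arrow. -/
def coords (g : Arrows) : ℂ × ℂ × ℂ × ℂ := ofModel (chartFun 0 g)

theorem coords_mem (g : Arrows) : coords g ∈ coordDomain :=
  div_ne_zero ((mem_arrows_iff g).1 g.2).2 ((mem_arrows_iff g).1 g.2).1

@[simp]
theorem coords_ofCoords (m : coordDomain) : coords (ofCoords m) = m :=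
  congrArg ofModel ((blowUpChart 0).right_inv (Set.mem_univ (toModel m)))

theorem chartInv_toModel_coords (g : Arrows) : chartInv 0 (toModel (coords g)) = g := by
  rw [coords, toModel_ofModel]
  exact (blowUpChart 0).left_inv ((mem_arrows_iff g).1 g.2).1

theorem ofCoords_coords (g : Arrows) : ofCoords ⟨coords g, coords_mem g⟩ = g :=
  Subtype.ext (chartInv_toModel_coords g)

theorem coords_injective : Function.Injective coords := fun g h hgh => by
  simpa only [hgh, ofCoords_coords] using (ofCoords_coords g).symm

/-- The target map in coordinates. -/
def tgtCoords (m : ℂ × ℂ × ℂ × ℂ) : ℂ × ℂ := (m.2.1, m.1)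

/-- The source map in coordinates. -/
def srcCoords (m : ℂ × ℂ × ℂ × ℂ) : ℂ × ℂ := (m.2.1 * m.2.2.1, m.2.1 * m.2.2.2 + m.1)

theorem blowDown_eq_coords (g : Arrows) :
    blowDown g = (tgtCoords (coords g), srcCoords (coords g)) := by
  conv_lhs => rw [← chartInv_toModel_coords g]
  simp [blowDown, chartInv, tgtCoords, srcCoords, affineVec, toModel, add_comm]

theorem mem_regularArrows_iff (g : Arrows) : g ∈ regularArrows ↔ (coords g).2.1 ≠ 0 := by
  change (blowDown g).1.1 ≠ 0 ∧ (blowDown g).2.1 ≠ 0 ↔ _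
  rw [blowDown_eq_coords]
  exact and_iff_left_of_imp fun ha => mul_ne_zero ha (coords_mem g)

instance : IsManifold 𝓘(ℂ, ChartModel) ∞ BlowUp := IsManifold.of_le (n := ω) le_top

section CoordFormulas

variable {𝕜 : Type*} [NontriviallyNormedField 𝕜] [NormedAlgebra 𝕜 ℂ]

theorem contDiff_toModel : ContDiff 𝕜 ∞ toModel :=
  contDiff_fst.prodMk <| (contDiff_fst.comp contDiff_snd).prodMk <|
    contDiff_pi.2 <| Fin.forall_fin_two.2
      ⟨(by fun_prop : ContDiff 𝕜 ∞ fun m : ℂ × ℂ × ℂ × ℂ => m.2.2.1),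
        (by fun_prop : ContDiff 𝕜 ∞ fun m : ℂ × ℂ × ℂ × ℂ => m.2.2.2)⟩

theorem contDiff_tgtCoords : ContDiff 𝕜 ∞ tgtCoords := by
  unfold tgtCoords
  fun_prop

theorem contDiff_srcCoords : ContDiff 𝕜 ∞ srcCoords := by
  unfold srcCoords
  fun_prop

end CoordFormulas

section Smooth

variable {𝕜 : Type*} [NontriviallyNormedField 𝕜] [NormedAlgebra 𝕜 ℂ]
  [IsManifold 𝓘(𝕜, ChartModel) ∞ BlowUp]
  {V : Type*} [NormedAddCommGroup V] [NormedSpace 𝕜 V] {H : Type*} [TopologicalSpace H]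
  {I : ModelWithCorners 𝕜 V H} {N : Type*} [TopologicalSpace N] [ChartedSpace H N]

theorem blowUpChart_mem_maximalAtlas (i : Fin 3) :
    blowUpChart i ∈ IsManifold.maximalAtlas 𝓘(𝕜, ChartModel) ∞ BlowUp :=
  IsManifold.subset_maximalAtlas (Set.mem_range_self i)

theorem contMDiff_coords : ContMDiff 𝓘(𝕜, ChartModel) 𝓘(𝕜, ℂ × ℂ × ℂ × ℂ) ∞ coords := by
  have hmodel : ContDiff 𝕜 ∞ ofModel := by
    unfold ofModel
    fun_prop
  exact hmodel.contMDiff.comp <|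
    (contMDiffOn_of_mem_maximalAtlas (blowUpChart_mem_maximalAtlas 0)).comp_contMDiff
      contMDiff_subtype_val fun g => ((mem_arrows_iff g).1 g.2).1

theorem contMDiff_chartInv (i : Fin 3) :
    ContMDiff 𝓘(𝕜, ChartModel) 𝓘(𝕜, ChartModel) ∞ (chartInv i) :=
  contMDiffOn_univ.1 (contMDiffOn_symm_of_mem_maximalAtlas (blowUpChart_mem_maximalAtlas i))

theorem contMDiffOn_of_coords {f : N → Arrows} {s : Set N}
    (hf : ContMDiffOn I 𝓘(𝕜, ℂ × ℂ × ℂ × ℂ) ∞ (fun x => coords (f x)) s) :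
    ContMDiffOn I 𝓘(𝕜, ChartModel) ∞ f s := fun x hx => by
  rw [← ContMDiffWithinAt.subtypeVal_comp_iff]
  have h := ((contMDiff_chartInv 0).comp contDiff_toModel.contMDiff).contMDiffAt
    |>.comp_contMDiffWithinAt x (hf x hx)
  exact h.congr (fun y _ => (chartInv_toModel_coords _).symm) (chartInv_toModel_coords _).symm

theorem contMDiff_of_coords {f : N → Arrows}
    (hf : ContMDiff I 𝓘(𝕜, ℂ × ℂ × ℂ × ℂ) ∞ fun x => coords (f x)) :
    ContMDiff I 𝓘(𝕜, ChartModel) ∞ f :=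
  contMDiffOn_univ.1 (contMDiffOn_of_coords hf.contMDiffOn)

variable (𝕜) in
/-- The global coordinates `(z, a, b, c)` on the arrow space, as a diffeomorphism over `𝕜 = ℝ` or
`𝕜 = ℂ`. -/
def coordDiffeomorph :
    coordDomain ≃ₘ^∞⟮𝓘(𝕜, ℂ × ℂ × ℂ × ℂ), 𝓘(𝕜, ChartModel)⟯ Arrows where
  toFun := ofCoords
  invFun g := ⟨coords g, coords_mem g⟩
  left_inv m := Subtype.ext (coords_ofCoords m)
  right_inv := ofCoords_coords
  contMDiff_toFun := contMDiff_of_coords (contMDiff_subtype_val.congr coords_ofCoords)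
  contMDiff_invFun := (ContMDiff.subtypeVal_comp_iff _ _).1 contMDiff_coords

variable (𝕜) in
theorem isLocalDiffeomorph_coords :
    IsLocalDiffeomorph 𝓘(𝕜, ChartModel) 𝓘(𝕜, ℂ × ℂ × ℂ × ℂ) ∞ coords := fun g =>
  ((coordDiffeomorph 𝕜).symm.isLocalDiffeomorph g).comp _ _
    (isLocalDiffeomorph_subtypeVal coordDomain _)

end Smooth

/-! ### The regular arrows -/

/-- The coordinates `(z, a, b, c)` of the regular arrow `((a, z), (a * b, a * c + z))`. -/
def pairCoords (x : (ℂ × ℂ) × (ℂ × ℂ)) : ℂ × ℂ × ℂ × ℂ :=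
  (x.1.2, x.1.1, x.2.1 / x.1.1, (x.2.2 - x.1.2) / x.1.1)

theorem pairCoords_mem {x : (ℂ × ℂ) × (ℂ × ℂ)} (hx : x ∈ pairArrows) :
    pairCoords x ∈ coordDomain :=
  div_ne_zero hx.2 hx.1

theorem pairCoords_blowDown {g : Arrows} (hg : g ∈ regularArrows) :
    pairCoords (blowDown g) = coords g := by
  have ha := (mem_regularArrows_iff g).1 hg
  simp [blowDown_eq_coords, pairCoords, tgtCoords, srcCoords, ha]

theorem tgtCoords_srcCoords_pairCoords {x : (ℂ × ℂ) × (ℂ × ℂ)} (hx : x ∈ pairArrows) :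
    (tgtCoords (pairCoords x), srcCoords (pairCoords x)) = x := by
  simp [pairCoords, tgtCoords, srcCoords, mul_div_cancel₀ _ hx.1]

theorem blowDown_injOn_regularArrows :
    Set.InjOn (fun g : Arrows => blowDown g) regularArrows := fun g hg h hh hgh => by
  apply coords_injective
  rw [← pairCoords_blowDown hg, ← pairCoords_blowDown hh]
  exact congrArg pairCoords hgh

/-- The blow-down map over `(ℂ^* × ℂ)²`, as a biholomorphism. -/
def regularDiffeomorph :
    regularArrows ≃ₘ^∞⟮𝓘(ℂ, ChartModel), 𝓘(ℂ, (ℂ × ℂ) × (ℂ × ℂ))⟯ pairArrows where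
  toFun g := ⟨blowDown g.1, g.2⟩
  invFun x := ⟨ofCoords ⟨pairCoords x, pairCoords_mem x.2⟩,
    (mem_regularArrows_iff _).2 (by simpa [pairCoords] using x.2.1)⟩
  left_inv g := Subtype.ext (coords_injective (by simpa using pairCoords_blowDown g.2))
  right_inv x := Subtype.ext <| by
    simpa [blowDown_eq_coords] using tgtCoords_srcCoords_pairCoords x.2
  contMDiff_toFun := by
    rw [← ContMDiff.subtypeVal_comp_iff]
    have h := (contDiff_tgtCoords (𝕜 := ℂ)).prodMk contDiff_srcCoords
    exact (h.contMDiff.comp (contMDiff_coords.comp contMDiff_subtype_val)).congr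
      fun g => blowDown_eq_coords g.1
  contMDiff_invFun := by
    rw [← ContMDiff.subtypeVal_comp_iff]
    have h : ContDiffOn ℂ ∞ pairCoords pairArrows := by
      unfold pairCoords
      fun_prop (disch := exact fun _ hx => hx.1)
    exact contMDiff_of_coords <| (h.contMDiffOn.comp_contMDiff contMDiff_subtype_val
      fun x => x.2).congr fun x => coords_ofCoords _

instance : T2Space Arrows :=
  T2Space.of_injective_continuous coords_injective (contMDiff_coords (𝕜 := ℂ)).continuous

theorem dense_regularArrows : Dense (regularArrows : Set Arrows) := by
  have ha : Dense {m : ℂ × ℂ × ℂ × ℂ | m.2.1 ≠ 0} :=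
    ((dense_compl_singleton (0 : ℂ)).preimage isOpenMap_fst).preimage isOpenMap_snd
  convert ha.preimage (isLocalDiffeomorph_coords ℂ).isOpenMap using 1
  exact Set.ext mem_regularArrows_iff

/-! ### The groupoid -/

/-- The product in coordinates: `(b₁, c₁)` and `(b₂, c₂)` are multiplied as elements of the
affine group, `(b₁, c₁) * (b₂, c₂) = (b₁ * b₂, b₁ * c₂ + c₁)`, and the target is kept. -/
def mulCoords (m n : ℂ × ℂ × ℂ × ℂ) : ℂ × ℂ × ℂ × ℂ :=
  (m.1, m.2.1, m.2.2.1 * n.2.2.1, m.2.2.1 * n.2.2.2 + m.2.2.2)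

/-- The inverse in coordinates. -/
def invCoords (m : ℂ × ℂ × ℂ × ℂ) : ℂ × ℂ × ℂ × ℂ :=
  (m.2.1 * m.2.2.2 + m.1, m.2.1 * m.2.2.1, m.2.2.1⁻¹, -(m.2.2.1⁻¹ * m.2.2.2))

/-- The units in coordinates. -/
def oneCoords (p : ℂ × ℂ) : ℂ × ℂ × ℂ × ℂ := (p.2, p.1, 1, 0)

theorem mulCoords_mem {m n : ℂ × ℂ × ℂ × ℂ} (hm : m ∈ coordDomain) (hn : n ∈ coordDomain) :
    mulCoords m n ∈ coordDomain :=
  mul_ne_zero hm hn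

theorem invCoords_mem {m : ℂ × ℂ × ℂ × ℂ} (hm : m ∈ coordDomain) : invCoords m ∈ coordDomain :=
  inv_ne_zero hm

theorem oneCoords_mem (p : ℂ × ℂ) : oneCoords p ∈ coordDomain :=
  one_ne_zero (α := ℂ)

theorem tgtCoords_mulCoords (m n : ℂ × ℂ × ℂ × ℂ) : tgtCoords (mulCoords m n) = tgtCoords m := rfl

theorem srcCoords_mulCoords {m n : ℂ × ℂ × ℂ × ℂ} (hmn : srcCoords m = tgtCoords n) :
    srcCoords (mulCoords m n) = srcCoords n := by
  obtain ⟨z, a, b, c⟩ := m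
  obtain ⟨z', a', b', c'⟩ := n
  obtain ⟨rfl, rfl⟩ := Prod.mk.inj hmn
  simp only [srcCoords, mulCoords, Prod.mk.injEq]
  constructor <;> ring

theorem mulCoords_assoc (m n k : ℂ × ℂ × ℂ × ℂ) :
    mulCoords (mulCoords m n) k = mulCoords m (mulCoords n k) := by
  simp only [mulCoords, Prod.mk.injEq, true_and]
  constructor <;> ring

theorem oneCoords_mulCoords (m : ℂ × ℂ × ℂ × ℂ) : mulCoords (oneCoords (tgtCoords m)) m = m := by
  simp [mulCoords, oneCoords, tgtCoords]

theorem mulCoords_oneCoords (m : ℂ × ℂ × ℂ × ℂ) (p : ℂ × ℂ) : mulCoords m (oneCoords p) = m := by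
  simp [mulCoords, oneCoords]

theorem tgtCoords_oneCoords (p : ℂ × ℂ) : tgtCoords (oneCoords p) = p := rfl

theorem srcCoords_oneCoords (p : ℂ × ℂ) : srcCoords (oneCoords p) = p := by
  simp [srcCoords, oneCoords]

theorem tgtCoords_invCoords (m : ℂ × ℂ × ℂ × ℂ) : tgtCoords (invCoords m) = srcCoords m := rfl

theorem srcCoords_invCoords {m : ℂ × ℂ × ℂ × ℂ} (hm : m ∈ coordDomain) :
    srcCoords (invCoords m) = tgtCoords m := by
  have hb : m.2.2.1 ≠ 0 := hm
  simp [srcCoords, tgtCoords, invCoords, mul_assoc, hb]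

theorem mulCoords_invCoords {m : ℂ × ℂ × ℂ × ℂ} (hm : m ∈ coordDomain) :
    mulCoords m (invCoords m) = oneCoords (tgtCoords m) := by
  have hb : m.2.2.1 ≠ 0 := hm
  simp [mulCoords, invCoords, oneCoords, tgtCoords, hb]

theorem invCoords_mulCoords {m : ℂ × ℂ × ℂ × ℂ} (hm : m ∈ coordDomain) :
    mulCoords (invCoords m) m = oneCoords (srcCoords m) := by
  have hb : m.2.2.1 ≠ 0 := hm
  simp [mulCoords, invCoords, oneCoords, srcCoords, hb]

theorem invCoords_invCoords {m : ℂ × ℂ × ℂ × ℂ} (hm : m ∈ coordDomain) :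
    invCoords (invCoords m) = m := by
  have hb : m.2.2.1 ≠ 0 := hm
  simp [invCoords, mul_assoc, hb]

section Smooth

variable {𝕜 : Type*} [NontriviallyNormedField 𝕜] [NormedAlgebra 𝕜 ℂ]

theorem contDiff_mulCoords : ContDiff 𝕜 ∞ fun x : (ℂ × ℂ × ℂ × ℂ) × (ℂ × ℂ × ℂ × ℂ) =>
    mulCoords x.1 x.2 := by
  unfold mulCoords
  fun_prop

theorem contDiffOn_invCoords : ContDiffOn 𝕜 ∞ invCoords coordDomain := by
  have hb : ContDiffOn 𝕜 ∞ (fun m : ℂ × ℂ × ℂ × ℂ => m.2.2.1⁻¹) coordDomain :=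
    ContDiffOn.inv (by fun_prop) fun _ hm => hm
  unfold invCoords
  fun_prop

theorem contDiff_oneCoords : ContDiff 𝕜 ∞ oneCoords := by
  unfold oneCoords
  fun_prop

end Smooth

/-- The inverse of an arrow. -/
def invArrow (g : Arrows) : Arrows := ofCoords ⟨invCoords (coords g), invCoords_mem (coords_mem g)⟩

@[simp]
theorem coords_invArrow (g : Arrows) : coords (invArrow g) = invCoords (coords g) :=
  coords_ofCoords _

theorem invArrow_invArrow (g : Arrows) : invArrow (invArrow g) = g :=
  coords_injective (by simp [invCoords_invCoords (coords_mem g)])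

/-- The arrow with target `q` and the same coordinates `b`, `c` as `g`. -/
def withTgt (q : ℂ × ℂ) (g : Arrows) : Arrows :=
  ofCoords ⟨(q.2, q.1, (coords g).2.2), coords_mem g⟩

@[simp]
theorem coords_withTgt (q : ℂ × ℂ) (g : Arrows) :
    coords (withTgt q g) = (q.2, q.1, (coords g).2.2) :=
  coords_ofCoords _

theorem withTgt_tgtCoords (g : Arrows) : withTgt (tgtCoords (coords g)) g = g :=
  coords_injective (by simp [tgtCoords])

theorem tgtCoords_withTgt (q : ℂ × ℂ) (g : Arrows) : tgtCoords (coords (withTgt q g)) = q := by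
  simp [tgtCoords]

section Smooth

variable {𝕜 : Type*} [NontriviallyNormedField 𝕜] [NormedAlgebra 𝕜 ℂ]
  [IsManifold 𝓘(𝕜, ChartModel) ∞ BlowUp]

theorem contMDiff_invArrow : ContMDiff 𝓘(𝕜, ChartModel) 𝓘(𝕜, ChartModel) ∞ invArrow :=
  contMDiff_of_coords <| (contDiffOn_invCoords.contMDiffOn.comp_contMDiff contMDiff_coords
    coords_mem).congr coords_invArrow

theorem contMDiff_withTgt : ContMDiff (𝓘(𝕜, ℂ × ℂ).prod 𝓘(𝕜, ChartModel)) 𝓘(𝕜, ChartModel) ∞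
    fun x : (ℂ × ℂ) × Arrows => withTgt x.1 x.2 := by
  have h : ContDiff 𝕜 ∞ fun y : (ℂ × ℂ) × (ℂ × ℂ × ℂ × ℂ) => (y.1.2, y.1.1, y.2.2.2) := by
    fun_prop
  exact contMDiff_of_coords <| (h.contMDiff.comp <| contMDiff_fst.prodMk_space <|
    contMDiff_coords.comp contMDiff_snd).congr fun x => coords_withTgt x.1 x.2

theorem contMDiff_withTgt_left (g : Arrows) :
    ContMDiff 𝓘(𝕜, ℂ × ℂ) 𝓘(𝕜, ChartModel) ∞ fun q => withTgt q g :=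
  contMDiff_withTgt.comp (contMDiff_id.prodMk contMDiff_const)

theorem surjective_mfderiv_tgt (g : Arrows) : Function.Surjective
    (mfderiv 𝓘(𝕜, ChartModel) 𝓘(𝕜, ℂ × ℂ) (fun g : Arrows => tgtCoords (coords g)) g) :=
  surjective_mfderiv_of_section (σ := fun q => withTgt q g)
    ((contDiff_tgtCoords.contMDiff.comp contMDiff_coords).mdifferentiableAt (by simp))
    ((contMDiff_withTgt_left g).mdifferentiableAt (by simp)) (fun q => tgtCoords_withTgt q g)
    (withTgt_tgtCoords g)

theorem surjective_mfderiv_src (g : Arrows) : Function.Surjective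
    (mfderiv 𝓘(𝕜, ChartModel) 𝓘(𝕜, ℂ × ℂ) (fun g : Arrows => srcCoords (coords g)) g) :=
  surjective_mfderiv_of_section (σ := fun q => invArrow (withTgt q (invArrow g)))
    ((contDiff_srcCoords.contMDiff.comp contMDiff_coords).mdifferentiableAt (by simp))
    ((contMDiff_invArrow.comp (contMDiff_withTgt_left _)).mdifferentiableAt (by simp))
    (fun q => by
      rw [coords_invArrow, srcCoords_invCoords (coords_mem _), tgtCoords_withTgt])
    (by rw [← tgtCoords_invCoords, ← coords_invArrow, withTgt_tgtCoords, invArrow_invArrow])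

end Smooth

/-- The extension of the pair groupoid of `ℂ^* × ℂ` to the arrow space: the action groupoid of the
affine group `{(b, c) | b ≠ 0}` acting on `ℂ²` by `(a, z) · (b, c) = (a * b, a * c + z)`. -/
def ellipticGroupoid : LieGroupoid ChartModel Arrows (ℂ × ℂ) (ℂ × ℂ) where
  src g := srcCoords (coords g)
  tgt g := tgtCoords (coords g)
  one p := ofCoords ⟨oneCoords p, oneCoords_mem p⟩
  inv := invArrow
  mul g h _ := ofCoords ⟨mulCoords (coords g) (coords h),
    mulCoords_mem (coords_mem g) (coords_mem h)⟩
  src_mul g h hgh := by simpa using srcCoords_mulCoords hgh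
  tgt_mul g h _ := by simp [tgtCoords_mulCoords]
  mul_assoc g h k _ _ := coords_injective (by simp [mulCoords_assoc])
  src_one p := by simp [srcCoords_oneCoords]
  tgt_one p := by simp [tgtCoords_oneCoords]
  one_mul g := coords_injective (by simp [oneCoords_mulCoords])
  mul_one g := coords_injective (by simp [mulCoords_oneCoords])
  src_inv g := by simp [srcCoords_invCoords (coords_mem g)]
  tgt_inv g := by simp [tgtCoords_invCoords]
  inv_mul g := coords_injective (by simp [invCoords_mulCoords (coords_mem g)])
  mul_inv g := coords_injective (by simp [mulCoords_invCoords (coords_mem g)])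
  contMDiff_src := contDiff_srcCoords.contMDiff.comp contMDiff_coords
  contMDiff_tgt := contDiff_tgtCoords.contMDiff.comp contMDiff_coords
  src_submersion := surjective_mfderiv_src
  tgt_submersion := surjective_mfderiv_tgt
  contMDiff_one := contMDiff_of_coords (contDiff_oneCoords.contMDiff.congr fun _ =>
    coords_ofCoords _)
  contMDiff_inv := contMDiff_invArrow
  contMDiffOn_mul := contMDiffOn_of_coords <|
    (contDiff_mulCoords.contMDiff.comp <| (contMDiff_coords.comp contMDiff_fst).prodMk_space <|
      contMDiff_coords.comp contMDiff_snd).contMDiffOn.congr fun _ hx =>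
        (congrArg coords (dif_pos hx)).trans (coords_ofCoords _)

theorem extendsPairGroupoid_ellipticGroupoid : ExtendsPairGroupoid ellipticGroupoid where
  tgt_eq g _ := by rw [blowDown_eq_coords]; rfl
  src_eq g _ := by rw [blowDown_eq_coords]; rfl
  one_eq p _ := by
    rw [blowDown_eq_coords]
    exact Prod.ext (ellipticGroupoid.tgt_one p) (ellipticGroupoid.src_one p)
  inv_eq g _ := by
    rw [blowDown_eq_coords, blowDown_eq_coords]
    exact Prod.ext (ellipticGroupoid.tgt_inv g) (ellipticGroupoid.src_inv g)
  mul_eq g _ h _ hgh := by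
    rw [blowDown_eq_coords, blowDown_eq_coords, blowDown_eq_coords]
    exact Prod.ext (ellipticGroupoid.tgt_mul g h hgh) (ellipticGroupoid.src_mul g h hgh)

/-! ### Uniqueness of the extension -/

theorem composable_subset_closure_regular :
    {x : Arrows × Arrows | ellipticGroupoid.src x.1 = ellipticGroupoid.tgt x.2} ⊆
      closure {x | x ∈ (regularArrows : Set Arrows) ×ˢ (regularArrows : Set Arrows) ∧
        ellipticGroupoid.src x.1 = ellipticGroupoid.tgt x.2} := by
  -- changing the target of the second arrow retracts all pairs onto the composable ones, and maps
  -- a pair whose first arrow is regular to a pair of regular arrows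
  let retract : Arrows × Arrows → Arrows × Arrows := fun x =>
    (x.1, withTgt (ellipticGroupoid.src x.1) x.2)
  have hcont : Continuous retract := continuous_fst.prodMk <|
    (contMDiff_withTgt (𝕜 := ℝ)).continuous.comp <|
      (ellipticGroupoid.contMDiff_src.continuous.comp continuous_fst).prodMk continuous_snd
  have hdense : Dense ((regularArrows : Set Arrows) ×ˢ (Set.univ : Set Arrows)) :=
    dense_regularArrows.prod dense_univ
  intro x hx
  have hfix : retract x = x := Prod.ext rfl <| by
    change withTgt (ellipticGroupoid.src x.1) x.2 = x.2
    rw [show ellipticGroupoid.src x.1 = ellipticGroupoid.tgt x.2 from hx]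
    exact withTgt_tgtCoords x.2
  rw [← hfix]
  refine map_mem_closure hcont (hdense x) fun y hy => ⟨⟨hy.1, ?_⟩, (tgtCoords_withTgt _ _).symm⟩
  refine (mem_regularArrows_iff _).2 ?_
  rw [coords_withTgt]
  exact mul_ne_zero ((mem_regularArrows_iff _).1 hy.1) (coords_mem y.1)

theorem eq_ellipticGroupoid {𝒢 : LieGroupoid ChartModel Arrows (ℂ × ℂ) (ℂ × ℂ)}
    (h𝒢 : ExtendsPairGroupoid 𝒢) : 𝒢 = ellipticGroupoid := by
  have hℋ := extendsPairGroupoid_ellipticGroupoid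
  refine LieGroupoid.ext_of_dense dense_regularArrows composable_subset_closure_regular
    (fun g hg => (h𝒢.src_eq g hg).trans (hℋ.src_eq g hg).symm)
    (fun g hg => (h𝒢.tgt_eq g hg).trans (hℋ.tgt_eq g hg).symm) fun g hg h hh hgh hgh' => ?_
  have hregular : ∀ k : Arrows, blowDown k = ((blowDown g).1, (blowDown h).2) →
      k ∈ regularArrows := fun k hk => by
    change blowDown k ∈ pairArrows
    rw [hk]
    exact ⟨hg.1, hh.2⟩
  have hmul := h𝒢.mul_eq g hg h hh hgh
  have hmul' := hℋ.mul_eq g hg h hh hgh'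
  exact blowDown_injOn_regularArrows (hregular _ hmul) (hregular _ hmul') (hmul.trans hmul'.symm)

/-! ### The Poisson structure in complex coordinates -/

theorem realForm_apply_eq_sum (ξ : (ℂ × ℂ) →L[ℝ] ℝ) (v : ℂ × ℂ) :
    ξ v = v.1.re * ξ (1, 0) + v.1.im * ξ (Complex.I, 0)
      + v.2.re * ξ (0, 1) + v.2.im * ξ (0, Complex.I) := by
  have hv : v = v.1.re • ((1, 0) : ℂ × ℂ) + v.1.im • ((Complex.I, 0) : ℂ × ℂ)
      + v.2.re • ((0, 1) : ℂ × ℂ) + v.2.im • ((0, Complex.I) : ℂ × ℂ) := by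
    ext <;> simp
  conv_lhs => rw [hv]
  simp only [map_add, map_smul, smul_eq_mul]

/-- The real covector `v ↦ Re Ω(w, v)` on `ℂ²`, where `Ω = dz₁ ∧ dz₂`; it identifies `ℂ²` with its
real dual in such a way that `π♯` becomes multiplication by the first coordinate. -/
def covector : (ℂ × ℂ) ≃L[ℝ] ((ℂ × ℂ) →L[ℝ] ℝ) :=
  LinearEquiv.toContinuousLinearEquiv
    { toFun := fun w => Complex.reCLM.comp
        (w.1 • ContinuousLinearMap.snd ℝ ℂ ℂ - w.2 • ContinuousLinearMap.fst ℝ ℂ ℂ)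
      map_add' := fun w w' => by
        ext v <;> simp <;> ring
      map_smul' := fun r w => by
        ext v <;> simp <;> ring
      invFun := fun ξ => (ξ (0, 1) - ξ (0, Complex.I) * Complex.I,
        -ξ (1, 0) + ξ (Complex.I, 0) * Complex.I)
      left_inv := fun w => by
        ext <;> simp
      right_inv := fun ξ => by
        ext v <;> simp [realForm_apply_eq_sum ξ (v, 0), realForm_apply_eq_sum ξ (0, v)] <;> ring }

theorem covector_apply (w v : ℂ × ℂ) : covector w v = (w.1 * v.2 - w.2 * v.1).re := rfl

theorem poissonSharp_covector (p w : ℂ × ℂ) : poissonSharp p (covector w) = p.1 • w := by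
  change realCoords (ellipticSharp (realCoords.symm p)
    ((covector w).comp (realCoords : R4 →L[ℝ] ℂ × ℂ))) = _
  have hr : ∀ x : R4, realCoords x = (⟨x 0, x 1⟩, ⟨x 2, -x 3⟩) := fun _ => rfl
  have hs : realCoords.symm p = ![p.1.re, p.1.im, p.2.re, -p.2.im] := rfl
  rw [ellipticSharp_apply, hs]
  simp only [ContinuousLinearMap.comp_apply, ContinuousLinearEquiv.coe_coe, covector_apply, hr]
  refine Prod.ext (Complex.ext ?_ ?_) (Complex.ext ?_ ?_) <;> simp <;> ring

/-- The bracket of the cotangent Lie algebroid in terms of the `ℂ²`-valued functions that represent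
one-forms by `covector`. -/
def covectorBracket (u w : ℂ × ℂ → ℂ × ℂ) (x : ℂ × ℂ) : ℂ × ℂ :=
  fderiv ℝ w x (x.1 • u x) - fderiv ℝ u x (x.1 • w x) + ((u x).1 • w x - (w x).1 • u x)

theorem fderiv_fst_smul {w : ℂ × ℂ → ℂ × ℂ} {x : ℂ × ℂ} (hw : DifferentiableAt ℝ w x)
    (v : ℂ × ℂ) : fderiv ℝ (fun y => y.1 • w y) x v = x.1 • fderiv ℝ w x v + v.1 • w x := by
  rw [fderiv_fun_smul (by fun_prop) hw]
  simp [fderiv_fst]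

theorem koszulBracket_covector {u w : ℂ × ℂ → ℂ × ℂ} {x : ℂ × ℂ} (hu : DifferentiableAt ℝ u x)
    (hw : DifferentiableAt ℝ w x) :
    koszulBracket poissonSharp (fun y => covector (u y)) (fun y => covector (w y)) x =
      covector (covectorBracket u w x) := by
  have hderiv : ∀ {f : ℂ × ℂ → ℂ × ℂ}, DifferentiableAt ℝ f x → ∀ v,
      fderiv ℝ (fun y => covector (f y)) x v = covector (fderiv ℝ f x v) := fun hf v =>
    congrArg (· v) (covector.hasFDerivAt.comp x hf.hasFDerivAt).fderiv
  refine ContinuousLinearMap.ext fun v => ?_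
  have hβ : DifferentiableAt ℝ (fun y => covector (w y)) x :=
    covector.differentiableAt.comp x hw
  have hX : DifferentiableAt ℝ (fun y => poissonSharp y (covector (u y))) x := by
    simp only [poissonSharp_covector]
    fun_prop
  rw [koszulBracket_apply hβ hX]
  simp only [poissonSharp_covector, hderiv hu, hderiv hw, fderiv_fst_smul hw, covectorBracket,
    covector_apply, ← Complex.sub_re]
  congr 1
  simp
  ring

/-! ### Right-invariant vector fields in coordinates -/

/-- The tangent vector at `m` of the source fibre through `m` that is obtained by right translation
from the tangent vector along the units represented by `w`. -/
def invariantLift (m : ℂ × ℂ × ℂ × ℂ) : ℂ × ℂ →ₗ[ℝ] ℂ × ℂ × ℂ × ℂ where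
  toFun w := (m.2.1 * w.2, m.2.1 * w.1, -(m.2.2.1 * w.1), -(m.2.2.2 * w.1) - w.2)
  map_add' w w' := by
    refine Prod.ext ?_ (Prod.ext ?_ (Prod.ext ?_ ?_)) <;> simp <;> ring
  map_smul' r w := by
    refine Prod.ext ?_ (Prod.ext ?_ (Prod.ext ?_ ?_)) <;> simp <;> ring

/-- The right-invariant vector field on the arrows, in coordinates, given along the units by the
function `w`. -/
def invariantField (w : ℂ × ℂ → ℂ × ℂ) (m : ℂ × ℂ × ℂ × ℂ) : ℂ × ℂ × ℂ × ℂ :=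
  invariantLift m (w (tgtCoords m))

theorem invariantField_eq (w : ℂ × ℂ → ℂ × ℂ) : invariantField w = fun m =>
    (m.2.1 * (w (tgtCoords m)).2, m.2.1 * (w (tgtCoords m)).1,
      -(m.2.2.1 * (w (tgtCoords m)).1), -(m.2.2.2 * (w (tgtCoords m)).1) - (w (tgtCoords m)).2) :=
  rfl

theorem isLinearMap_tgtCoords : IsLinearMap ℝ tgtCoords := ⟨fun _ _ => rfl, fun _ _ => rfl⟩

theorem fderiv_tgtCoords (m v : ℂ × ℂ × ℂ × ℂ) : fderiv ℝ tgtCoords m v = tgtCoords v :=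
  congrArg (· v) (isLinearMap_tgtCoords.mk' _).toContinuousLinearMap.hasFDerivAt.fderiv

theorem fderiv_srcCoords (m v : ℂ × ℂ × ℂ × ℂ) : fderiv ℝ srcCoords m v =
    (v.2.1 * m.2.2.1 + m.2.1 * v.2.2.1, v.2.1 * m.2.2.2 + m.2.1 * v.2.2.2 + v.1) := by
  unfold srcCoords
  simp (disch := fun_prop) [DifferentiableAt.fderiv_prodMk, fderiv_fun_add, fderiv_fun_mul,
    fderiv.fst, fderiv.snd, mul_comm, add_comm]

theorem fderiv_mulCoords_left (m n v : ℂ × ℂ × ℂ × ℂ) :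
    fderiv ℝ (fun m => mulCoords m n) m v = mulCoords v n := by
  have hlin : IsLinearMap ℝ fun m => mulCoords m n := by
    constructor <;> intros <;> simp [mulCoords, mul_assoc, add_mul, add_add_add_comm]
  exact congrArg (· v) (hlin.mk' _).toContinuousLinearMap.hasFDerivAt.fderiv

theorem tgtCoords_invariantLift (m : ℂ × ℂ × ℂ × ℂ) (w : ℂ × ℂ) :
    tgtCoords (invariantLift m w) = (tgtCoords m).1 • w := rfl

theorem mulCoords_invariantLift (m n : ℂ × ℂ × ℂ × ℂ) (w : ℂ × ℂ) :
    mulCoords (invariantLift m w) n = invariantLift (mulCoords m n) w := by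
  simp only [mulCoords, invariantLift, LinearMap.coe_mk, AddHom.coe_mk, Prod.mk.injEq, true_and]
  constructor <;> ring

theorem fderiv_srcCoords_invariantLift (m : ℂ × ℂ × ℂ × ℂ) (w : ℂ × ℂ) :
    fderiv ℝ srcCoords m (invariantLift m w) = 0 := by
  rw [fderiv_srcCoords]
  ext1 <;> simp [invariantLift] <;> ring

theorem injective_invariantLift {m : ℂ × ℂ × ℂ × ℂ} (hm : m ∈ coordDomain) :
    Function.Injective (invariantLift m) := by
  refine (injective_iff_map_eq_zero _).2 fun w hw => ?_
  have hb : m.2.2.1 ≠ 0 := hm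
  obtain ⟨-, -, h₁, h₂⟩ : _ ∧ _ ∧ w.1 = 0 ∧ _ := by simpa [invariantLift, hb] using hw
  exact Prod.ext h₁ (by simpa [h₁] using h₂)

theorem range_invariantLift {m : ℂ × ℂ × ℂ × ℂ} (hm : m ∈ coordDomain) :
    Set.range (invariantLift m) = {v | fderiv ℝ srcCoords m v = 0} := by
  refine Set.Subset.antisymm
    (Set.range_subset_iff.2 (fderiv_srcCoords_invariantLift m)) fun v hv => ?_
  have hb : m.2.2.1 ≠ 0 := hm
  have hv' : fderiv ℝ srcCoords m v = 0 := hv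
  rw [fderiv_srcCoords] at hv'
  obtain ⟨h₁, h₂⟩ := Prod.mk.inj hv'
  refine ⟨(-(v.2.2.1 / m.2.2.1), m.2.2.2 * (v.2.2.1 / m.2.2.1) - v.2.2.2), ?_⟩
  simp only [invariantLift, LinearMap.coe_mk, AddHom.coe_mk]
  refine Prod.ext ?_ (Prod.ext ?_ (Prod.ext ?_ ?_))
  · field_simp
    linear_combination m.2.2.2 * h₁ - m.2.2.1 * h₂
  · field_simp
    linear_combination -h₁
  · field_simp
  · field_simp
    ring

theorem contDiff_invariantField {w : ℂ × ℂ → ℂ × ℂ} (hw : ContDiff ℝ ∞ w) :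
    ContDiff ℝ ∞ (invariantField w) := by
  have hwt : ContDiff ℝ ∞ fun m => w (tgtCoords m) := hw.comp contDiff_tgtCoords
  exact (ContDiff.mul (by fun_prop) hwt.snd).prodMk <|
    (ContDiff.mul (by fun_prop) hwt.fst).prodMk <|
      (ContDiff.mul (by fun_prop) hwt.fst).neg.prodMk
        ((ContDiff.mul (by fun_prop) hwt.fst).neg.sub hwt.snd)

theorem fderiv_invariantField {w : ℂ × ℂ → ℂ × ℂ} {m : ℂ × ℂ × ℂ × ℂ}
    (hw : DifferentiableAt ℝ w (tgtCoords m)) (v : ℂ × ℂ × ℂ × ℂ) :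
    fderiv ℝ (invariantField w) m v =
      invariantLift m (fderiv ℝ w (tgtCoords m) (tgtCoords v)) +
        (v.2.1 * (w (tgtCoords m)).2, v.2.1 * (w (tgtCoords m)).1,
          -(v.2.2.1 * (w (tgtCoords m)).1), -(v.2.2.2 * (w (tgtCoords m)).1)) := by
  have ht : DifferentiableAt ℝ tgtCoords m := (contDiff_tgtCoords.differentiable (by simp)) m
  have : DifferentiableAt ℝ (fun m => w (tgtCoords m)) m := hw.comp m ht
  have hwt : fderiv ℝ (fun m => w (tgtCoords m)) m v =
      fderiv ℝ w (tgtCoords m) (tgtCoords v) := by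
    rw [fderiv_fun_comp m hw ht, ContinuousLinearMap.comp_apply, fderiv_tgtCoords]
  simp (disch := fun_prop) only [invariantField_eq, DifferentiableAt.fderiv_prodMk, fderiv_fun_mul,
    fderiv_fun_sub, fderiv_fun_neg]
  refine Prod.ext ?_ (Prod.ext ?_ (Prod.ext ?_ ?_)) <;>
    simp (disch := fun_prop) [invariantLift, hwt, fderiv.fst, fderiv.snd] <;> ring

theorem lieBracket_invariantField {u w : ℂ × ℂ → ℂ × ℂ} {m : ℂ × ℂ × ℂ × ℂ}
    (hu : DifferentiableAt ℝ u (tgtCoords m)) (hw : DifferentiableAt ℝ w (tgtCoords m)) :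
    VectorField.lieBracket ℝ (invariantField u) (invariantField w) m =
      invariantField (covectorBracket u w) m := by
  rw [VectorField.lieBracket, fderiv_invariantField hu, fderiv_invariantField hw]
  simp only [invariantField, tgtCoords_invariantLift, covectorBracket, map_add, map_sub]
  refine Prod.ext ?_ (Prod.ext ?_ (Prod.ext ?_ ?_)) <;> simp [invariantLift] <;> ring

/-! ### The Lie algebroid -/

/-- The derivative of the coordinates at an arrow, as an isomorphism of real tangent spaces. -/
def coordsDeriv (g : Arrows) :
    TangentSpace 𝓘(ℝ, ChartModel) g ≃L[ℝ] TangentSpace 𝓘(ℝ, ℂ × ℂ × ℂ × ℂ) (coords g) :=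
  (isLocalDiffeomorph_coords ℝ g).mfderivToContinuousLinearEquiv (by simp)

theorem hasMFDerivAt_coords (g : Arrows) :
    HasMFDerivAt 𝓘(ℝ, ChartModel) 𝓘(ℝ, ℂ × ℂ × ℂ × ℂ) coords g (coordsDeriv g) := by
  rw [coordsDeriv, IsLocalDiffeomorphAt.mfderivToContinuousLinearEquiv_coe]
  exact ((contMDiff_coords.mdifferentiable (by simp)) g).hasMFDerivAt

theorem mfderiv_comp_coords {V : Type*} [NormedAddCommGroup V] [NormedSpace ℝ V]
    {f : ℂ × ℂ × ℂ × ℂ → V} {g : Arrows} (hf : DifferentiableAt ℝ f (coords g))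
    (v : TangentSpace 𝓘(ℝ, ChartModel) g) :
    mfderiv 𝓘(ℝ, ChartModel) 𝓘(ℝ, V) (fun g => f (coords g)) g v =
      fderiv ℝ f (coords g) (coordsDeriv g v) :=
  DFunLike.congr_fun (hf.hasFDerivAt.hasMFDerivAt.comp g (hasMFDerivAt_coords g)).mfderiv v

theorem mfderiv_src (g : Arrows) (v : TangentSpace 𝓘(ℝ, ChartModel) g) :
    mfderiv 𝓘(ℝ, ChartModel) 𝓘(ℝ, ℂ × ℂ) ellipticGroupoid.src g v =
      fderiv ℝ srcCoords (coords g) (coordsDeriv g v) :=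
  mfderiv_comp_coords (contDiff_srcCoords.differentiable (by simp) _) v

theorem mfderiv_tgt (g : Arrows) (v : TangentSpace 𝓘(ℝ, ChartModel) g) :
    mfderiv 𝓘(ℝ, ChartModel) 𝓘(ℝ, ℂ × ℂ) ellipticGroupoid.tgt g v =
      tgtCoords (coordsDeriv g v) :=
  (mfderiv_comp_coords (contDiff_tgtCoords.differentiable (by simp) _) v).trans
    (fderiv_tgtCoords _ _)

/-- The right-invariant vector field on the arrow space given along the units by the function `w`;
see `invariantField`. -/
def arrowField (w : ℂ × ℂ → ℂ × ℂ) (g : Arrows) : TangentSpace 𝓘(ℝ, ChartModel) g :=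
  VectorField.mpullback 𝓘(ℝ, ChartModel) 𝓘(ℝ, ℂ × ℂ × ℂ × ℂ) coords (invariantField w) g

theorem mpullback_coords (X : ∀ m, TangentSpace 𝓘(ℝ, ℂ × ℂ × ℂ × ℂ) m) (g : Arrows) :
    VectorField.mpullback 𝓘(ℝ, ChartModel) 𝓘(ℝ, ℂ × ℂ × ℂ × ℂ) coords X g =
      (coordsDeriv g).symm (X (coords g)) := by
  rw [VectorField.mpullback_apply, (hasMFDerivAt_coords g).mfderiv,
    ContinuousLinearMap.inverse_equiv]
  rfl

theorem coordsDeriv_arrowField (w : ℂ × ℂ → ℂ × ℂ) (g : Arrows) :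
    coordsDeriv g (arrowField w g) = invariantField w (coords g) :=
  (congrArg (coordsDeriv g) (mpullback_coords (invariantField w) g)).trans
    ((coordsDeriv g).apply_symm_apply _)

theorem contMDiff_arrowField {w : ℂ × ℂ → ℂ × ℂ} (hw : ContDiff ℝ ∞ w) :
    ContMDiff 𝓘(ℝ, ChartModel) 𝓘(ℝ, ChartModel).tangent ∞
      (fun g => (⟨g, arrowField w g⟩ : TangentBundle 𝓘(ℝ, ChartModel) Arrows)) :=
  ContMDiff.mpullback_vectorField
    (contMDiff_vectorSpace_iff_contDiff.2 (contDiff_invariantField hw)) contMDiff_coords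
    (fun g => ⟨coordsDeriv g, (hasMFDerivAt_coords g).mfderiv.symm⟩) (by simp)

/-- Right translation by `h`, extended from the source fibre over `t(h)` to all arrows by the
formula for the product in coordinates. -/
def rightTranslation (h g : Arrows) : Arrows :=
  ofCoords ⟨mulCoords (coords g) (coords h), mulCoords_mem (coords_mem g) (coords_mem h)⟩

theorem coords_rightTranslation (h g : Arrows) :
    coords (rightTranslation h g) = mulCoords (coords g) (coords h) :=
  coords_ofCoords _

theorem rightMul_eq_rightTranslation {h g : Arrows}
    (hgh : ellipticGroupoid.src g = ellipticGroupoid.tgt h) :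
    ellipticGroupoid.rightMul h g = rightTranslation h g := by
  simp only [LieGroupoid.rightMul, hgh, dite_true]
  rfl

theorem contMDiff_rightTranslation (h : Arrows) :
    ContMDiff 𝓘(ℝ, ChartModel) 𝓘(ℝ, ChartModel) ∞ (rightTranslation h) :=
  contMDiff_of_coords <|
    ((contDiff_mulCoords.comp (contDiff_id.prodMk contDiff_const)).contMDiff.comp
      contMDiff_coords).congr (coords_rightTranslation h)

theorem mfderiv_rightTranslation_arrowField (w : ℂ × ℂ → ℂ × ℂ) (h g : Arrows) :
    mfderiv 𝓘(ℝ, ChartModel) 𝓘(ℝ, ChartModel) (rightTranslation h) g (arrowField w g) =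
      arrowField w (rightTranslation h g) := by
  apply (coordsDeriv _).injective
  have hR := ((contMDiff_rightTranslation h).mdifferentiable (by simp) g).hasMFDerivAt
  have hcomp := (hasMFDerivAt_coords _).comp g hR
  have hmul : DifferentiableAt ℝ (fun m => mulCoords m (coords h)) (coords g) :=
    (contDiff_mulCoords.comp (contDiff_id.prodMk contDiff_const)).differentiable (by simp) _
  have hfun : coords ∘ rightTranslation h = fun g => mulCoords (coords g) (coords h) :=
    funext (coords_rightTranslation h)
  rw [hfun] at hcomp
  have hleft : coordsDeriv _ (mfderiv _ _ (rightTranslation h) g (arrowField w g)) =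
      mulCoords (coordsDeriv g (arrowField w g)) (coords h) :=
    (DFunLike.congr_fun hcomp.mfderiv (arrowField w g)).symm.trans
      ((mfderiv_comp_coords hmul _).trans (fderiv_mulCoords_left _ _ _))
  rw [hleft, coordsDeriv_arrowField, coordsDeriv_arrowField, coords_rightTranslation]
  exact mulCoords_invariantLift _ _ _

theorem isRightInvariant_arrowField {w : ℂ × ℂ → ℂ × ℂ} (hw : ContDiff ℝ ∞ w) :
    ellipticGroupoid.IsRightInvariant (arrowField w) where
  smooth := contMDiff_arrowField hw
  vertical g := by
    rw [mfderiv_src, coordsDeriv_arrowField]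
    exact fderiv_srcCoords_invariantLift _ _
  invariant g h hgh := by
    have hR := ((contMDiff_rightTranslation h).mdifferentiable (by simp) g).hasMFDerivAt
    rw [rightMul_eq_rightTranslation hgh]
    exact ⟨_, hR.hasMFDerivWithinAt.congr_mono (fun _ => rightMul_eq_rightTranslation)
      (rightMul_eq_rightTranslation hgh) subset_rfl, mfderiv_rightTranslation_arrowField w h g⟩

theorem mlieBracket_arrowField {u w : ℂ × ℂ → ℂ × ℂ} (hu : ContDiff ℝ ∞ u)
    (hw : ContDiff ℝ ∞ w) :
    VectorField.mlieBracket 𝓘(ℝ, ChartModel) (arrowField u) (arrowField w) =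
      arrowField (covectorBracket u w) := funext fun g => by
  have : IsManifold 𝓘(ℝ, ChartModel) (minSmoothness ℝ 3) Arrows := by
    rw [minSmoothness_of_isRCLikeNormedField]
    exact IsManifold.of_le (n := ∞) (WithTop.coe_le_coe.2 le_top)
  have hsmooth : ∀ {f : ℂ × ℂ → ℂ × ℂ}, ContDiff ℝ ∞ f → _ := fun {f} hf =>
    (contMDiff_vectorSpace_iff_contDiff (V := invariantField f)).2 (contDiff_invariantField hf)
      |>.mdifferentiable (by simp) (coords g)
  have h := VectorField.mpullback_mlieBracket (n := ∞) (hsmooth hu) (hsmooth hw)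
    contMDiff_coords.contMDiffAt (by
      rw [minSmoothness_of_isRCLikeNormedField]
      exact WithTop.coe_le_coe.2 le_top)
  have hbracket := (congrFun (mlieBracket_eq_lieBracket _ _) _).trans
    (lieBracket_invariantField (hu.differentiable (by simp) (tgtCoords (coords g)))
      (hw.differentiable (by simp) _))
  exact h.symm.trans <| (mpullback_coords _ g).trans <|
    (congrArg (coordsDeriv g).symm hbracket).trans
      (mpullback_coords (invariantField (covectorBracket u w)) g).symm

/-- The isomorphism from the cotangent bundle to the Lie algebroid: the covector represented by `w`
is sent to the tangent vector along the units represented by `w`. -/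
def algebroidIso (x : ℂ × ℂ) :
    ((ℂ × ℂ) →L[ℝ] ℝ) →ₗ[ℝ] TangentSpace 𝓘(ℝ, ChartModel) (ellipticGroupoid.one x) :=
  (coordsDeriv (ellipticGroupoid.one x)).symm.toLinearMap ∘ₗ invariantLift (oneCoords x) ∘ₗ
    covector.symm.toLinearMap

theorem coords_one (x : ℂ × ℂ) : coords (ellipticGroupoid.one x) = oneCoords x :=
  coords_ofCoords _

theorem coordsDeriv_algebroidIso (x : ℂ × ℂ) (ξ : (ℂ × ℂ) →L[ℝ] ℝ) :
    coordsDeriv _ (algebroidIso x ξ) = invariantLift (oneCoords x) (covector.symm ξ) :=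
  (coordsDeriv _).apply_symm_apply _

theorem arrowField_one (w : ℂ × ℂ → ℂ × ℂ) (x : ℂ × ℂ) :
    arrowField w (ellipticGroupoid.one x) = algebroidIso x (covector (w x)) := by
  apply (coordsDeriv _).injective
  rw [coordsDeriv_arrowField, coordsDeriv_algebroidIso, coords_one,
    ContinuousLinearEquiv.symm_apply_apply]
  rfl

theorem injective_algebroidIso (x : ℂ × ℂ) : Function.Injective (algebroidIso x) :=
  (coordsDeriv _).symm.injective.comp
    ((injective_invariantLift (oneCoords_mem x)).comp covector.symm.injective)

theorem range_algebroidIso (x : ℂ × ℂ) : Set.range (algebroidIso x) =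
    {v | mfderiv 𝓘(ℝ, ChartModel) 𝓘(ℝ, ℂ × ℂ) ellipticGroupoid.src
      (ellipticGroupoid.one x) v = 0} := by
  ext v
  have hv : v ∈ Set.range (algebroidIso x) ↔
      coordsDeriv _ v ∈ Set.range (invariantLift (oneCoords x)) := by
    simp only [Set.mem_range, ← (coordsDeriv _).injective.eq_iff, coordsDeriv_algebroidIso]
    exact (covector.symm.surjective.exists
      (p := fun w => invariantLift (oneCoords x) w = coordsDeriv _ v)).symm
  rw [hv, range_invariantLift (oneCoords_mem x), ← coords_one]
  exact (Eq.congr_left (mfderiv_src _ v)).symm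

theorem mfderiv_tgt_algebroidIso (x : ℂ × ℂ) (ξ : (ℂ × ℂ) →L[ℝ] ℝ) :
    mfderiv 𝓘(ℝ, ChartModel) 𝓘(ℝ, ℂ × ℂ) ellipticGroupoid.tgt (ellipticGroupoid.one x)
      (algebroidIso x ξ) = poissonSharp x ξ := by
  obtain ⟨w, rfl⟩ := covector.surjective ξ
  rw [mfderiv_tgt, coordsDeriv_algebroidIso, tgtCoords_invariantLift, tgtCoords_oneCoords,
    ContinuousLinearEquiv.symm_apply_apply, poissonSharp_covector]

theorem integratesCotangent_ellipticGroupoid :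
    IntegratesCotangent ellipticGroupoid poissonSharp := by
  have hrep : ∀ α : ℂ × ℂ → (ℂ × ℂ) →L[ℝ] ℝ, ContDiff ℝ ∞ α →
      ∃ w, ContDiff ℝ ∞ w ∧ α = fun x => covector (w x) := fun α hα =>
    ⟨fun x => covector.symm (α x), covector.symm.contDiff.comp hα,
      funext fun x => (covector.apply_symm_apply (α x)).symm⟩
  refine ⟨algebroidIso, injective_algebroidIso, range_algebroidIso, fun α hα => ?_,
    mfderiv_tgt_algebroidIso, fun α β hα hβ => ?_⟩
  · obtain ⟨w, hw, rfl⟩ := hrep α hα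
    simp only [← arrowField_one]
    exact (contMDiff_arrowField hw).comp ellipticGroupoid.contMDiff_one
  · obtain ⟨u, hu, rfl⟩ := hrep α hα
    obtain ⟨w, hw, rfl⟩ := hrep β hβ
    refine ⟨arrowField u, arrowField w, isRightInvariant_arrowField hu,
      isRightInvariant_arrowField hw, arrowField_one u, arrowField_one w, fun x => ?_⟩
    change _ = algebroidIso x (koszulBracket poissonSharp (fun x => covector (u x))
      (fun x => covector (w x)) x)
    rw [mlieBracket_arrowField hu hw, arrowField_one,
      koszulBracket_covector (hu.differentiable (by simp) x) (hw.differentiable (by simp) x)]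

end EllipticModel

end

theorem mainTheorem12 :
    -- the inverse image of `(ℂ^* × ℂ)²` lies in the arrow space, where `β` is biholomorphic
    EllipticModel.blowDown ⁻¹' EllipticModel.pairArrows ⊆ EllipticModel.Arrows ∧
    (∃ Ψ : EllipticModel.regularArrows
        ≃ₘ^∞⟮𝓘(ℂ, EllipticModel.ChartModel), 𝓘(ℂ, (ℂ × ℂ) × (ℂ × ℂ))⟯ EllipticModel.pairArrows,
      ∀ g, (Ψ g : (ℂ × ℂ) × (ℂ × ℂ)) = EllipticModel.blowDown g.1.1) ∧
    -- global holomorphic coordinates `(z, a, b, c)`, `b ≠ 0`, on the arrow space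
    ∃ Φ : EllipticModel.coordDomain
        ≃ₘ^∞⟮𝓘(ℂ, ℂ × ℂ × ℂ × ℂ), 𝓘(ℂ, EllipticModel.ChartModel)⟯ EllipticModel.Arrows,
      (∀ (z a b c : ℂ) (hb : b ≠ 0),
        EllipticModel.blowDown (Φ ⟨(z, a, b, c), hb⟩).1 = ((a, z), (a * b, a * c + z))) ∧
      -- the unique extension of the pair groupoid
      ∃ 𝒢 : EllipticModel.LieGroupoid EllipticModel.ChartModel EllipticModel.Arrows
          (ℂ × ℂ) (ℂ × ℂ),
        EllipticModel.ExtendsPairGroupoid 𝒢 ∧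
        (∀ 𝒢' : EllipticModel.LieGroupoid EllipticModel.ChartModel EllipticModel.Arrows
          (ℂ × ℂ) (ℂ × ℂ), EllipticModel.ExtendsPairGroupoid 𝒢' → 𝒢' = 𝒢) ∧
        (∀ (z a b c : ℂ) (hb : b ≠ 0),
          𝒢.src (Φ ⟨(z, a, b, c), hb⟩) = (a * b, a * c + z) ∧
          𝒢.tgt (Φ ⟨(z, a, b, c), hb⟩) = (a, z)) ∧
        EllipticModel.IntegratesCotangent 𝒢 EllipticModel.poissonSharp := by
  have hcoords : ∀ (z a b c : ℂ) (hb : b ≠ 0), EllipticModel.coords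
      (EllipticModel.coordDiffeomorph ℂ ⟨(z, a, b, c), hb⟩) = (z, a, b, c) :=
    fun _ _ _ _ _ => EllipticModel.coords_ofCoords _
  refine ⟨EllipticModel.preimage_pairArrows_subset,
    ⟨EllipticModel.regularDiffeomorph, fun _ => rfl⟩,
    EllipticModel.coordDiffeomorph ℂ, fun z a b c hb => ?_,
    EllipticModel.ellipticGroupoid, EllipticModel.extendsPairGroupoid_ellipticGroupoid,
    fun _ => EllipticModel.eq_ellipticGroupoid, fun z a b c hb => ?_,
    EllipticModel.integratesCotangent_ellipticGroupoid⟩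
  · rw [EllipticModel.blowDown_eq_coords, hcoords]
    rfl
  · exact ⟨congrArg EllipticModel.srcCoords (hcoords z a b c hb),
      congrArg EllipticModel.tgtCoords (hcoords z a b c hb)⟩
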